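/- Let $p$ be a prime and let $\mathcal F$ be a saturated fusion system on a finite $p$-group $S$. Let $P_1=S,P_2,\dots,P_r\le S$ be subgroups and $L_1,\dots,L_r$ finite groups exhibiting $\mathcal F$ as an Alperin fusion system, that is: for each $i$, $N_S(P_i)$ is embedded in $L_i$ as a Sylow $p$-subgroup in such a way that $P_i=O_p(L_i)$, $C_{L_i}(P_i)=Z(P_i)$, $L_i/P_i\cong \mathrm{Out}_{\mathcal F}(P_i)$ and $\mathcal F_{N_S(P_i)}(L_i)\subseteq\mathcal F$, and $\mathcal F$ is generated by the $\mathcal F_{N_S(P_i)}(L_i)$. For each $i$ choose finitely many subgroups of $L_i$ that generate $L_i$ and each of which contains an isomorphic copy of $N_S(P_i)$. Let $K_1,\dots,K_n$ be a list of all the chosen subgroups; after reindexing (and repeating) the $P$'s, write $N_S(P_j)$ for the group whose copy $K_j$ contains, and assume that $N_S(P_1)=S$, so that $S\in \mathrm{Syl}_p(K_1)$. Let $$G=K_1\underset{N_S(P_2)}{*}K_2\underset{N_S(P_3)}{*}\cdots\underset{N_S(P_n)}{*}K_n$$ be the iterated amalgam, in which $N_S(P_j)$ is embedded in $K_j$ and,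 through $S$, in $K_1$. Then $G$ has torsion-free subgroups of finite index, every such subgroup $\Gamma$ is of type FP, and the rational Euler characteristic $\chi(G)=\chi(\Gamma)/[G:\Gamma]$, where $\chi(\Gamma)=\sum_m(-1)^m\,\mathrm{rank}\,H_m(\Gamma;\mathbb Z)$, does not depend on $\Gamma$ and is $$\chi(G)=\sum_{1\le i\le n}\frac1{|K_i|}-\sum_{2\le i\le n}\frac1{|N_S(P_i)|}.$$ Moreover $$\chi(G)=\frac{d_{\mathcal F}}{|S|\cdot\mathrm{lcm}\{[K_i:N_S(P_i)] : 1\le i\le n\}}$$ for some integer $d_{\mathcal F}$, and $d_{\mathcal F}$ is negative unless $G$ is virtually cyclic (that is, unless $G$ has a cyclic subgroup of finite index, which may be trivial). -/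

import Mathlib

open CategoryTheory
open scoped MonoidAlgebra

/-! ### Fusion systems -/

/-- A fusion system on `S`: a category whose objects are the subgroups of `S`, whose morphisms are
injective group homomorphisms, which contains all conjugations by elements of `S` (in particular
identities and inclusions), and in which every morphism is an isomorphism of the category followed
by an inclusion. -/
structure FusionSystem (S : Type) [Group S] where
  Hom : ∀ P Q : Subgroup S, Set (P →* Q)
  injective : ∀ {P Q : Subgroup S} {φ : P →* Q}, φ ∈ Hom P Q → Function.Injective φ
  conj_mem : ∀ {P Q : Subgroup S} (g : S) (φ : P →* Q),
    (∀ x : P, (φ x : S) = g * (x : S) * g⁻¹) → φ ∈ Hom P Q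
  comp_mem : ∀ {P Q R : Subgroup S} {ψ : Q →* R} {φ : P →* Q},
    ψ ∈ Hom Q R → φ ∈ Hom P Q → ψ.comp φ ∈ Hom P R
  factor : ∀ {P Q : Subgroup S} {φ : P →* Q}, φ ∈ Hom P Q →
    ∃ (R : Subgroup S) (_ : R ≤ Q) (e : P ≃* R),
      e.toMonoidHom ∈ Hom P R ∧ e.symm.toMonoidHom ∈ Hom R P ∧ ∀ x : P, (φ x : S) = (e x : S)

namespace FusionSystem

variable {S : Type} [Group S]

/-- `F` is contained in `F'`. -/
def Contained (F F' : FusionSystem S) : Prop :=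
  ∀ P Q : Subgroup S, F.Hom P Q ⊆ F'.Hom P Q

/-- `P` and `P'` are `F`-conjugate: they are isomorphic in `F`. -/
def Conjugate (F : FusionSystem S) (P P' : Subgroup S) : Prop :=
  ∃ e : P ≃* P', e.toMonoidHom ∈ F.Hom P P' ∧ e.symm.toMonoidHom ∈ F.Hom P' P

/-- `P` is fully centralized in `F`. -/
def FullyCentralized (F : FusionSystem S) (P : Subgroup S) : Prop :=
  ∀ P' : Subgroup S, F.Conjugate P P' →
    Nat.card (Subgroup.centralizer (P' : Set S)) ≤ Nat.card (Subgroup.centralizer (P : Set S))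

/-- `P` is fully normalized in `F`. -/
def FullyNormalized (F : FusionSystem S) (P : Subgroup S) : Prop :=
  ∀ P' : Subgroup S, F.Conjugate P P' →
    Nat.card (Subgroup.normalizer (P' : Set S)) ≤ Nat.card (Subgroup.normalizer (P : Set S))

/-- The group `Aut_F(P)`. -/
def aut (F : FusionSystem S) (P : Subgroup S) : Subgroup (MulAut P) where
  carrier := {e | MulEquiv.toMonoidHom e ∈ F.Hom P P}
  one_mem' := F.conj_mem 1 _ (fun x => by simp)
  mul_mem' := fun {_ _} ha hb => F.comp_mem ha hb
  inv_mem' := by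
    intro e he
    obtain ⟨R, hR, e', _, h2, h3⟩ := F.factor he
    have hPR : R = P := by
      refine le_antisymm hR (fun x hx => ?_)
      obtain ⟨y, hy⟩ := MulEquiv.surjective e ⟨x, hx⟩
      have h := h3 y
      rw [MulEquiv.coe_toMonoidHom, hy] at h
      have hx' : x = (e' y : S) := h
      rw [hx']
      exact (e' y).2
    subst hPR
    have hee : e = e' := MulEquiv.ext fun x => Subtype.ext (h3 x)
    subst hee
    exact h2

/-- The group `Aut_S(P)` of automorphisms of `P` induced by conjugation in `S`. -/
def autS (P : Subgroup S) : Subgroup (MulAut P) where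
  carrier := {e | ∃ g ∈ Subgroup.normalizer (P : Set S), ∀ x : P, (e x : S) = g * (x : S) * g⁻¹}
  one_mem' := ⟨1, one_mem _, fun x => by simp⟩
  mul_mem' := by
    rintro a b ⟨g, hg, ha⟩ ⟨h, hh, hb⟩
    refine ⟨g * h, mul_mem hg hh, fun x => ?_⟩
    rw [MulAut.mul_apply, ha, hb]
    group
  inv_mem' := by
    rintro a ⟨g, hg, ha⟩
    refine ⟨g⁻¹, inv_mem hg, fun x => ?_⟩
    have h := ha (a⁻¹ x)
    rw [MulAut.apply_inv_self] at h
    rw [h]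
    group

/-- The group `Inn(P)` of inner automorphisms. -/
def inn (P : Type) [Group P] : Subgroup (MulAut P) := (MulAut.conj : P →* MulAut P).range

instance inn_normal (P : Type) [Group P] : (inn P).Normal where
  conj_mem := by
    rintro _ ⟨x, rfl⟩ e
    refine ⟨e x, ?_⟩
    ext y
    simp [MulAut.mul_apply, MulAut.conj_apply]

/-- `Out_F(P) = Aut_F(P) / Inn(P)`. -/
abbrev Out (F : FusionSystem S) (P : Subgroup S) : Type :=
  F.aut P ⧸ (inn P).subgroupOf (F.aut P)

/-- For `φ : P → S` the subgroup `N_φ` of those `g ∈ N_S(P)` for which `φ c_g φ⁻¹` is induced by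
conjugation by an element of `N_S(φ(P))`. -/
def extender {P : Subgroup S} (φ : P →* (⊤ : Subgroup S)) : Subgroup S where
  carrier := {g | ∃ hg : g ∈ Subgroup.normalizer (P : Set S),
    ∃ h ∈ Subgroup.normalizer ((((⊤ : Subgroup S).subtype.comp φ).range : Subgroup S) : Set S),
      ∀ x : P, (φ ⟨g * (x : S) * g⁻¹, (Subgroup.mem_normalizer_iff.1 hg _).1 x.2⟩ : S)
        = h * (φ x : S) * h⁻¹}
  one_mem' := ⟨one_mem _, 1, one_mem _, fun x => by simp⟩
  mul_mem' := by
    rintro a b ⟨ha, h, hh, hah⟩ ⟨hb, k, hk, hbk⟩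
    refine ⟨mul_mem ha hb, h * k, mul_mem hh hk, fun x => ?_⟩
    have e1 := hah ⟨b * (x : S) * b⁻¹, (Subgroup.mem_normalizer_iff.1 hb _).1 x.2⟩
    rw [hbk x] at e1
    have e2 : (⟨a * b * (x : S) * (a * b)⁻¹,
        (Subgroup.mem_normalizer_iff.1 (mul_mem ha hb) _).1 x.2⟩ : P) =
        ⟨a * (b * (x : S) * b⁻¹) * a⁻¹, (Subgroup.mem_normalizer_iff.1 ha _).1
          ((Subgroup.mem_normalizer_iff.1 hb _).1 x.2)⟩ := by
      apply Subtype.ext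
      simp only [mul_assoc, mul_inv_rev]
    rw [e2, e1]
    group
  inv_mem' := by
    rintro a ⟨ha, h, hh, hah⟩
    refine ⟨inv_mem ha, h⁻¹, inv_mem hh, fun x => ?_⟩
    have e1 := hah ⟨a⁻¹ * (x : S) * a⁻¹⁻¹,
      (Subgroup.mem_normalizer_iff.1 (inv_mem ha) _).1 x.2⟩
    have e2 : (⟨a * (a⁻¹ * (x : S) * a⁻¹⁻¹) * a⁻¹, (Subgroup.mem_normalizer_iff.1 ha _).1
        ((Subgroup.mem_normalizer_iff.1 (inv_mem ha) _).1 x.2)⟩ : P) = x := by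
      apply Subtype.ext
      simp [mul_assoc]
    rw [e2] at e1
    rw [e1]
    group

/-- Saturated fusion systems at the prime `p`. -/
structure IsSaturated (F : FusionSystem S) (p : ℕ) : Prop where
  centralized : ∀ P : Subgroup S, F.FullyNormalized P → F.FullyCentralized P
  sylow : ∀ P : Subgroup S, F.FullyNormalized P →
    ∃ T : Sylow p (F.aut P), (T : Subgroup (F.aut P)) = (autS P).subgroupOf (F.aut P)
  extend : ∀ (P : Subgroup S) (φ : P →* (⊤ : Subgroup S)), φ ∈ F.Hom P ⊤ →
    F.FullyCentralized (((⊤ : Subgroup S).subtype.comp φ).range) →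
    ∃ ψ ∈ F.Hom (extender φ) ⊤, ∀ (x : S) (hx : x ∈ P) (hx' : x ∈ extender φ),
      ψ ⟨x, hx'⟩ = φ ⟨x, hx⟩

/-- The morphisms `Q → R` of the fusion system `F_N(L)` of a group `L` on a subgroup `N`, where `N`
is a subgroup of `S` that is embedded in `L` by `ι`: the conjugations by elements of `L`. -/
def localHom {N : Subgroup S} {L : Type} [Group L] (ι : N →* L) (Q R : Subgroup S) :
    Set (Q →* R) :=
  {φ | ∃ (hQ : Q ≤ N) (hR : R ≤ N) (l : L), ∀ x : Q,
    ι (Subgroup.inclusion hR (φ x)) = l * ι (Subgroup.inclusion hQ x) * l⁻¹}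

end FusionSystem

/-- `O_p(L)`, the largest normal `p`-subgroup of a finite group `L`. -/
def pCore (p : ℕ) (L : Type) [Group L] : Subgroup L :=
  sSup {N : Subgroup L | N.Normal ∧ IsPGroup p N}

instance pCore_normal (p : ℕ) (L : Type) [Group L] : (pCore p L).Normal := by
  rw [pCore, sSup_eq_iSup']
  have : ∀ a : {N : Subgroup L | N.Normal ∧ IsPGroup p N}, (a : Subgroup L).Normal :=
    fun a => a.2.1
  exact Subgroup.iSup_normal _

/-- Data exhibiting a fusion system `F` on `S` as an Alperin fusion system: subgroups
`P 0 = S, P 1, …, P r` of `S` and finite groups `L 0, …, L r`. The map `ι i` embeds `N_S(P i)`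
as a Sylow `p`-subgroup of `L i`. -/
structure AlperinData (p : ℕ) {S : Type} [Group S] (F : FusionSystem S) where
  r : ℕ
  P : Fin (r + 1) → Subgroup S
  L : Fin (r + 1) → Type
  [group : ∀ i, Group (L i)]
  [finite : ∀ i, Finite (L i)]
  ι : ∀ i, Subgroup.normalizer (P i : Set S) →* L i
  ι_injective : ∀ i, Function.Injective (ι i)
  P_zero : P 0 = ⊤
  sylow : ∀ i, ∃ T : Sylow p (L i), (T : Subgroup (L i)) = (ι i).range
  core : ∀ i, ((P i).subgroupOf (Subgroup.normalizer (P i : Set S))).map (ι i) = pCore p (L i)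
  centric : ∀ i, Subgroup.centralizer (pCore p (L i) : Set (L i)) =
    (Subgroup.center (pCore p (L i))).map (pCore p (L i)).subtype
  out : ∀ i, Nonempty ((L i ⧸ pCore p (L i)) ≃* F.Out (P i))
  contained : ∀ i Q R, FusionSystem.localHom (ι i) Q R ⊆ F.Hom Q R
  generated : ∀ F' : FusionSystem S,
    (∀ i Q R, FusionSystem.localHom (ι i) Q R ⊆ F'.Hom Q R) → F.Contained F'

attribute [instance] AlperinData.group AlperinData.finite

/-- The data of the amalgam model of a fusion system `F`: Alperin data `(P i, L i)` for `F`, and a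
finite list of groups `K 0, …, K n`, where `K j` is a subgroup of `L (idx j)` that contains an
isomorphic copy of `N_S(P (idx j))`, embedded by `emb j`. For each `i` the groups `K j` with
`idx j = i` generate `L i`, and `K 0` contains a copy of `S = N_S(P (idx 0))`. -/
structure AmalgamModel (p : ℕ) {S : Type} [Group S] (F : FusionSystem S)
    extends AlperinData p F where
  n : ℕ
  idx : Fin (n + 1) → Fin (r + 1)
  K : ∀ j, Subgroup (L (idx j))
  emb : ∀ j, Subgroup.normalizer (P (idx j) : Set S) →* K j
  emb_injective : ∀ j, Function.Injective (emb j)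
  generate : ∀ H : (∀ i, Subgroup (L i)), (∀ j, K j ≤ H (idx j)) → ∀ i, H i = ⊤
  normalizer_zero : Subgroup.normalizer (P (idx 0) : Set S) = ⊤

namespace AmalgamModel

variable {p : ℕ} {S : Type} [Group S] {F : FusionSystem S}

/-- The subgroup `N_S(P_j)` of `S` attached to `K j`. -/
def N (M : AmalgamModel p F) (j : Fin (M.n + 1)) : Subgroup S :=
  Subgroup.normalizer (M.P (M.idx j) : Set S)

/-- The embedding of `S` in `K 0`. -/
def embS (M : AmalgamModel p F) : S →* M.K 0 :=
  (M.emb 0).comp ((MonoidHom.id S).codRestrict _ (fun x => by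
    rw [M.normalizer_zero]; exact Subgroup.mem_top x))

/-- The relators of the amalgam: for `x ∈ N_S(P_j) ≤ S`, the image of `x` in `K j` is identified
with its image in `K 0`. -/
def relators (M : AmalgamModel p F) : Set (Monoid.CoprodI fun j => M.K j) :=
  {w | ∃ (j : Fin (M.n + 1)) (x : Subgroup.normalizer (M.P (M.idx j) : Set S)),
    w = Monoid.CoprodI.of (M := fun j => M.K j) (i := j) (M.emb j x) *
      (Monoid.CoprodI.of (M := fun j => M.K j) (i := 0) (M.embS x))⁻¹}

/-- The iterated amalgam `K 0 *_{N_S(P_1)} K 1 *_{N_S(P_2)} ⋯ *_{N_S(P_n)} K n`, in which the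
amalgamated subgroup `N_S(P_j)` is embedded in `K j` and, via `S`, in `K 0`. -/
abbrev G (M : AmalgamModel p F) : Type :=
  (Monoid.CoprodI fun j => M.K j) ⧸ Subgroup.normalClosure M.relators

/-- `[K_j : N_S(P_j)]`. -/
noncomputable def relIndex (M : AmalgamModel p F) (j : Fin (M.n + 1)) : ℕ := (M.emb j).range.index

end AmalgamModel

/-! ### The rational Euler characteristic -/

/-- `G` is of type FP: the trivial `ℤ[G]`-module `ℤ` has a resolution of finite length by finitely
generated projective modules. -/
def IsTypeFP (G : Type) [Group G] : Prop :=
  ∃ P : ProjectiveResolution (Rep.trivial ℤ G ℤ),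
    (∀ n, Module.Finite ℤ[G] (Rep.toModuleMonoidAlgebra.obj (P.complex.X n))) ∧
    ∃ d, ∀ n, d ≤ n → Limits.IsZero (P.complex.X n)

/-- `∑ (-1)^n rank H_n(G; ℤ)`, for groups `G` of type FP. -/
noncomputable def homologicalEulerChar (G : Type) [Group G] : ℤ :=
  ∑ᶠ n : ℕ, (-1) ^ n * (Module.finrank ℤ (groupHomology (Rep.trivial ℤ G ℤ) n) : ℤ)

/-- The rational Euler characteristic of `G` (in the sense of Wall) is defined and equals `χ`: there
are torsion-free subgroups of finite index in `G`, and every such subgroup `Γ` is of type FP and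
satisfies `χ = χ(Γ) / [G : Γ]`. -/
def HasRationalEulerChar (G : Type) [Group G] (χ : ℚ) : Prop :=
  (∃ Γ : Subgroup G, Γ.FiniteIndex ∧ ∀ g : Γ, IsOfFinOrder g → g = 1) ∧
  ∀ Γ : Subgroup G, Γ.FiniteIndex → (∀ g : Γ, IsOfFinOrder g → g = 1) →
    IsTypeFP Γ ∧ χ = (homologicalEulerChar Γ : ℚ) / (Γ.index : ℚ)

/-- `G` has a cyclic subgroup of finite index. -/
def IsVirtuallyCyclic (G : Type) [Group G] : Prop :=
  ∃ H : Subgroup G, H.FiniteIndex ∧ IsCyclic H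

/-! The group is a star of finite groups, amalgamated at a centre `o`, and acts on its Bass–Serre
tree with vertices `G / K j` and edges `G / N j` for `j ≠ o`. Acyclicity of the tree is the
exactness of `0 → ℤ[E] → ℤ[V] → ℤ → 0`. Here it is derived from the universal property alone:
connectedness from generation, absence of cycles from an affine action of `G` on `ℤ[E]`
(`IsStarAmalgam.boundary_injective`).

A torsion-free subgroup `Γ` of finite index meets all stabilizers trivially, so the sequence is a
free resolution over `ℤ[Γ]` with `[G : Γ] / |K j|` vertex orbits and `[G : Γ] / |N j|` edge orbits
of each type. This gives type FP and the formula. Such a `Γ` is the kernel of a map to a finite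
symmetric group that is injective on every `K j`; it exists because free actions of a finite group
on one finite set are conjugate.

The denominator comes from `|K j| = |N j| [K j : N j]` and `|N j|` dividing `|S|`. For the sign, put
`i = [K j : N j]` and `m = [K o : N j]`. If `χ ≥ 0`, the sum of `(1 - 1/i) m` over the edges with `i
≠ 1` is at most `1`. Each term is at least `1/2`, so at most two such edges remain, and the group is
finite or generated by two subgroups sharing a finite subgroup of index two. -/

/-! ### Euler characteristic of a complex concentrated in degrees 0 and 1. -/

theorem ShortComplex.finrank_homology_add_finrank_range {R : Type} [CommRing R] [IsDomain R]
    [IsNoetherianRing R] (S : ShortComplex (ModuleCat.{0} R)) [Module.Finite R S.X₂] :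
    Module.finrank R S.homology + Module.finrank R (LinearMap.range S.f.hom) =
      Module.finrank R (LinearMap.ker S.g.hom) := by
  have e : S.homology ≃ₗ[R] (LinearMap.ker S.g.hom ⧸ LinearMap.range S.moduleCatToCycles) :=
    S.moduleCatHomologyIso.toLinearEquiv
  rw [e.finrank_eq, ← Submodule.finrank_quotient_add_finrank (LinearMap.range S.moduleCatToCycles)]
  have : (LinearMap.range S.moduleCatToCycles).map (LinearMap.ker S.g.hom).subtype =
      LinearMap.range S.f.hom := by
    rw [← LinearMap.range_comp]
    rfl
  rw [← this]
  exact congrArg _ (Submodule.equivMapOfInjective _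
    (Submodule.subtype_injective _) _).finrank_eq.symm

/-- The rank of `C.d 1 0` is lost in both `H₀` and `H₁`, so it cancels in the alternating sum. -/
theorem ChainComplex.sum_finrank_homology {R : Type} [CommRing R] [IsDomain R]
    [IsNoetherianRing R] (C : ChainComplex (ModuleCat.{0} R) ℕ)
    [∀ n, Module.Finite R (C.X n)] (hC : ∀ n, 2 ≤ n → Limits.IsZero (C.X n)) :
    ∑ᶠ n : ℕ, (-1) ^ n * (Module.finrank R (C.homology n) : ℤ) =
      Module.finrank R (C.X 0) - Module.finrank R (C.X 1) := by
  have hz : ∀ n, 2 ≤ n → Module.finrank R (C.homology n) = 0 := by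
    intro n hn
    have : Limits.IsZero (C.homology n) := by
      apply ShortComplex.isZero_homology_of_isZero_X₂
      exact hC n hn
    have := ModuleCat.subsingleton_of_isZero this
    exact Module.finrank_zero_of_subsingleton
  rw [finsum_eq_sum_of_support_subset (s := Finset.range 2)]
  swap
  · intro n hn
    by_contra h
    simp only [Finset.coe_range, Set.mem_Iio, not_lt] at h
    simp [hz n h] at hn
  have : Module.Finite R (C.sc' 1 0 0).X₂ := inferInstanceAs (Module.Finite R (C.X 0))
  have : Module.Finite R (C.sc' 2 1 0).X₂ := inferInstanceAs (Module.Finite R (C.X 1))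
  -- The index after `0` defaults to `0` in a chain complex over `ℕ`; the outgoing map `C.d 0 0` is
  -- zero.
  have h0 := ShortComplex.finrank_homology_add_finrank_range (C.sc' 1 0 0)
  have h1 := ShortComplex.finrank_homology_add_finrank_range (C.sc' 2 1 0)
  have e0 : (C.sc' 1 0 0).homology ≃ₗ[R] C.homology 0 :=
    (ShortComplex.homologyMapIso (C.isoSc' 1 0 0 (by simp) (by simp))).symm.toLinearEquiv
  have e1 : (C.sc' 2 1 0).homology ≃ₗ[R] C.homology 1 :=
    (ShortComplex.homologyMapIso (C.isoSc' 2 1 0 (by simp) (by simp))).symm.toLinearEquiv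
  rw [e0.finrank_eq] at h0
  rw [e1.finrank_eq] at h1
  have k0 : Module.finrank R (LinearMap.ker (C.sc' 1 0 0).g.hom) = Module.finrank R (C.X 0) := by
    have : (C.sc' 1 0 0).g = 0 := C.shape _ _ (by simp)
    rw [this, ModuleCat.hom_zero, LinearMap.ker_zero]
    exact finrank_top R (C.X 0)
  have r2 : Module.finrank R (LinearMap.range (C.sc' 2 1 0).f.hom) = 0 := by
    have : (C.sc' 2 1 0).f = 0 := (hC 2 le_rfl).eq_of_src _ _
    rw [this, ModuleCat.hom_zero, LinearMap.range_zero]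
    exact finrank_bot R _
  have rn := Submodule.finrank_quotient_add_finrank (LinearMap.ker (C.d 1 0).hom)
  rw [(C.d 1 0).hom.quotKerEquivRange.finrank_eq] at rn
  change _ + Module.finrank R (LinearMap.range (C.d 1 0).hom) = _ at h0
  change _ = Module.finrank R (LinearMap.ker (C.d 1 0).hom) at h1
  simp only [Finset.sum_range_succ, Finset.range_zero, Finset.sum_empty]
  omega

/-! ### Free resolutions of length one. -/

section Resolution

variable {Γ : Type} [Group Γ] {Y₁ Y₀ : Type}

/-- The index sets of a resolution of length one by free modules. -/
def twoTermIndex (Y₁ Y₀ : Type) : ℕ → Type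
  | 0 => Y₀
  | 1 => Y₁
  | _ + 2 => Empty

instance twoTermIndex.finite [Finite Y₁] [Finite Y₀] : ∀ n, Finite (twoTermIndex Y₁ Y₀ n)
  | 0 => ‹Finite Y₀›
  | 1 => ‹Finite Y₁›
  | _ + 2 => inferInstanceAs (Finite Empty)

/-- The differentials of a resolution of length one by free modules. -/
noncomputable def twoTermD (d : Rep.free ℤ Γ Y₁ ⟶ Rep.free ℤ Γ Y₀) : ∀ n,
    Rep.free ℤ Γ (twoTermIndex Y₁ Y₀ (n + 1)) ⟶ Rep.free ℤ Γ (twoTermIndex Y₁ Y₀ n)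
  | 0 => d
  | _ + 1 => 0

/-- The chain complex `0 ⟶ ℤ[Γ]^Y₁ ⟶ ℤ[Γ]^Y₀`. -/
noncomputable abbrev twoTermComplex (d : Rep.free ℤ Γ Y₁ ⟶ Rep.free ℤ Γ Y₀) :
    ChainComplex (Rep ℤ Γ) ℕ :=
  ChainComplex.of (fun n => Rep.free ℤ Γ (twoTermIndex Y₁ Y₀ n)) (twoTermD d) fun _ => by
    simp [twoTermD]

theorem twoTermComplex_isZero (d : Rep.free ℤ Γ Y₁ ⟶ Rep.free ℤ Γ Y₀) {n : ℕ} (hn : 2 ≤ n) :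
    Limits.IsZero ((twoTermComplex d).X n) := by
  obtain ⟨m, rfl⟩ := Nat.exists_eq_add_of_le' hn
  rw [Rep.isZero_iff]
  exact inferInstanceAs (Subsingleton (Empty →₀ ℤ[Γ]))

theorem Rep.exact_of_forall {k G : Type} [CommRing k] [Group G] (S : ShortComplex (Rep.{0} k G))
    (h : ∀ x, S.g.hom x = 0 → ∃ y, S.f.hom y = x) : S.Exact := by
  apply (forget₂ _ (ModuleCat k)).reflects_exact_of_faithful
  rw [ShortComplex.moduleCat_exact_iff]
  exact h

/-- The projective resolution given by a short exact sequence
`0 ⟶ ℤ[Γ]^Y₁ ⟶ ℤ[Γ]^Y₀ ⟶ ℤ ⟶ 0`. -/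
theorem exists_twoTermResolution (d : Rep.free ℤ Γ Y₁ ⟶ Rep.free ℤ Γ Y₀)
    (ε : Rep.free ℤ Γ Y₀ ⟶ Rep.trivial ℤ Γ ℤ) (hd : Function.Injective d.hom)
    (hε : Function.Surjective ε.hom) (hdε : ∀ x, ε.hom x = 0 ↔ ∃ y, d.hom y = x) :
    ∃ P : ProjectiveResolution (Rep.trivial ℤ Γ ℤ), P.complex = twoTermComplex d := by
  have w : d ≫ ε = 0 := by
    refine Rep.hom_ext (Representation.IntertwiningMap.ext (LinearMap.ext fun x => ?_))
    exact (hdε _).2 ⟨x, rfl⟩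
  have h10 : (twoTermComplex d).d 1 0 = d :=
    ChainComplex.of_d (fun n => Rep.free ℤ Γ (twoTermIndex Y₁ Y₀ n)) (twoTermD d) 0
  refine ⟨{ complex := twoTermComplex d
            projective := fun n =>
              (inferInstance : Projective (Rep.free ℤ Γ (twoTermIndex Y₁ Y₀ n)))
            π := ((twoTermComplex d).toSingle₀Equiv _).symm ⟨ε, by rw [h10]; exact w⟩
            quasiIso := ⟨fun n => ?_⟩ }, rfl⟩
  cases n with
  | zero =>
    -- In degree zero the condition is exactness of `d` followed by `ε`, together with surjectivity
    -- of `ε`.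
    rw [ChainComplex.quasiIsoAt₀_iff, ShortComplex.quasiIso_iff_of_zeros' _ rfl rfl rfl]
    constructor
    · apply Rep.exact_of_forall
      intro x hx
      obtain ⟨y, hy⟩ := (hdε x).1 hx
      exact ⟨y, by rw [← hy]; exact congrArg (fun f => Rep.Hom.hom f y) h10⟩
    · rw [Rep.epi_iff_surjective]
      exact hε
  | succ n =>
    rw [quasiIsoAt_iff_exactAt' (hL := ChainComplex.exactAt_succ_single_obj ..),
      HomologicalComplex.exactAt_iff' _ (n + 2) (n + 1) n (by simp) (by simp)]
    apply Rep.exact_of_forall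
    cases n with
    | zero =>
      intro x hx
      -- Nothing comes in from degree two, so exactness in degree one is injectivity of `d`.
      refine ⟨0, ?_⟩
      rw [map_zero]
      apply hd
      exact (map_zero d.hom).trans
        ((congrArg (fun f => Rep.Hom.hom f x) h10).symm.trans hx).symm
    | succ n =>
      intro x _
      refine ⟨0, ?_⟩
      have : Subsingleton (Empty →₀ ℤ[Γ]) := inferInstance
      exact this.elim _ _

/-- A group `Γ` with a short exact sequence `0 ⟶ ℤ[Γ]^Y₁ ⟶ ℤ[Γ]^Y₀ ⟶ ℤ ⟶ 0`, where `Y₀` and `Y₁`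
are finite, is of type FP with Euler characteristic `|Y₀| - |Y₁|`. -/
theorem isTypeFP_and_homologicalEulerChar_of_free [Finite Y₁] [Finite Y₀]
    (d : Rep.free ℤ Γ Y₁ ⟶ Rep.free ℤ Γ Y₀)
    (ε : Rep.free ℤ Γ Y₀ ⟶ Rep.trivial ℤ Γ ℤ) (hd : Function.Injective d.hom)
    (hε : Function.Surjective ε.hom) (hdε : ∀ x, ε.hom x = 0 ↔ ∃ y, d.hom y = x) :
    IsTypeFP Γ ∧ homologicalEulerChar Γ = Nat.card Y₀ - Nat.card Y₁ := by
  classical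
  obtain ⟨P, hP⟩ := exists_twoTermResolution d ε hd hε hdε
  refine ⟨⟨P, ?_, 2, fun n hn => hP ▸ twoTermComplex_isZero d hn⟩, ?_⟩
  · rw [hP]
    intro n
    exact Module.Finite.of_basis (Representation.freeAsModuleBasis ℤ Γ (twoTermIndex Y₁ Y₀ n))
  -- Coinvariants turn `ℤ[Γ]^Y` into `ℤ^Y`, so the homology is that of a complex with ranks `|Y₀|`
  -- and `|Y₁|`.
  · let C := (twoTermComplex d).coinvariantsTensorObj (Rep.trivial ℤ Γ ℤ)
    have e (n : ℕ) : groupHomology (Rep.trivial ℤ Γ ℤ) n ≅ C.homology n := by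
      have := groupHomologyIso (Rep.trivial ℤ Γ ℤ) n P
      rw [hP] at this
      exact this
    have eX (n : ℕ) : C.X n ≃ₗ[ℤ] (twoTermIndex Y₁ Y₀ n →₀ ℤ) :=
      Rep.coinvariantsTensorFreeLEquiv (Rep.trivial ℤ Γ ℤ) (twoTermIndex Y₁ Y₀ n)
    have hfin (n : ℕ) : Module.Finite ℤ (C.X n) := Module.Finite.equiv (eX n).symm
    have hzero (n : ℕ) (hn : 2 ≤ n) : Limits.IsZero (C.X n) :=
      Functor.map_isZero ((Rep.coinvariantsTensor ℤ Γ).obj (Rep.trivial ℤ Γ ℤ))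
        (twoTermComplex_isZero d hn)
    have key := ChainComplex.sum_finrank_homology C hzero
    rw [(eX 0).finrank_eq, (eX 1).finrank_eq] at key
    have hcard (n : ℕ) : Module.finrank ℤ (twoTermIndex Y₁ Y₀ n →₀ ℤ) =
        Nat.card (twoTermIndex Y₁ Y₀ n) := by
      have := Fintype.ofFinite (twoTermIndex Y₁ Y₀ n)
      rw [Module.finrank_finsupp_self, Nat.card_eq_fintype_card]
    rw [hcard, hcard] at key
    refine Eq.trans ?_ key
    refine finsum_congr fun n => ?_
    rw [← (e n).toLinearEquiv.finrank_eq]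

end Resolution

/-! ### Free actions, permutation modules and torsion. -/

section FreeAction

/-- An action is free if only the identity has a fixed point. -/
def IsFreeAction (Γ X : Type) [Group Γ] [MulAction Γ X] : Prop :=
  ∀ (γ : Γ) (x : X), γ • x = x → γ = 1

/-- A set with a free action is a disjoint union of copies of the group. -/
noncomputable def IsFreeAction.prodOrbitsEquiv {Γ X : Type} [Group Γ] [MulAction Γ X]
    (h : IsFreeAction Γ X) : Γ × MulAction.orbitRel.Quotient Γ X ≃ X :=
  Equiv.ofBijective (fun a => a.1 • Quotient.out a.2) <| by
    constructor
    · rintro ⟨a, y⟩ ⟨b, z⟩ hab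
      replace hab : a • Quotient.out y = b • Quotient.out z := hab
      have hyz : y = z := by
        rw [← Quotient.out_eq y, ← Quotient.out_eq z]
        refine Quotient.sound ⟨a⁻¹ * b, ?_⟩
        change (a⁻¹ * b) • Quotient.out z = _
        rw [mul_smul, ← hab, inv_smul_smul]
      subst hyz
      have := h (b⁻¹ * a) (Quotient.out y) (by rw [mul_smul, hab, inv_smul_smul])
      rw [inv_mul_eq_one] at this
      rw [this]
    · intro x
      obtain ⟨γ, hγ⟩ := Quotient.exact (Quotient.out_eq (s := MulAction.orbitRel Γ X)
        (Quotient.mk _ x))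
      refine ⟨(γ⁻¹, Quotient.mk _ x), ?_⟩
      change γ⁻¹ • Quotient.out _ = x
      rw [← hγ]
      exact inv_smul_smul _ _

theorem IsFreeAction.prodOrbitsEquiv_mul {Γ X : Type} [Group Γ] [MulAction Γ X]
    (h : IsFreeAction Γ X) (a b : Γ) (y : MulAction.orbitRel.Quotient Γ X) :
    h.prodOrbitsEquiv (a * b, y) = a • h.prodOrbitsEquiv (b, y) :=
  mul_smul _ _ _

variable {Γ X Y : Type} [Group Γ]

/-- The permutation module on `Γ × Y` as a free module. -/
noncomputable def permEquiv (e : Γ × Y ≃ X) : (Y →₀ ℤ[Γ]) ≃ₗ[ℤ] (X →₀ ℤ) :=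
  (Finsupp.mapRange.linearEquiv (MonoidAlgebra.coeffLinearEquiv ℤ)) ≪≫ₗ
    (Finsupp.curryLinearEquiv ℤ).symm ≪≫ₗ Finsupp.domLCongr ((Equiv.prodComm _ _).trans e)

theorem permEquiv_single (e : Γ × Y ≃ X) (y : Y) (γ : Γ) (r : ℤ) :
    permEquiv e (Finsupp.single y (.single γ r)) = Finsupp.single (e (γ, y)) r := by
  simp [permEquiv]

variable [MulAction Γ X]

theorem permEquiv_free (e : Γ × Y ≃ X) (he : ∀ a b y, e (a * b, y) = a • e (b, y)) (γ : Γ)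
    (x : Y →₀ ℤ[Γ]) :
    permEquiv e (Representation.free ℤ Γ Y γ x) =
      Finsupp.mapDomain (γ • ·) (permEquiv e x) := by
  suffices h : (permEquiv e).toLinearMap ∘ₗ (Representation.free ℤ Γ Y γ) =
      Finsupp.lmapDomain ℤ ℤ (γ • · : X → X) ∘ₗ (permEquiv e).toLinearMap from
    LinearMap.congr_fun h x
  refine Finsupp.lhom_ext' fun y => MonoidAlgebra.lhom_ext' fun b => LinearMap.ext_ring ?_
  simp only [LinearMap.comp_apply, Finsupp.lsingle_apply, MonoidAlgebra.lsingle_apply,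
    LinearEquiv.coe_coe, Representation.free_single_single, permEquiv_single, he,
    Finsupp.lmapDomain_apply, Finsupp.mapDomain_single]

/-- The sum of the coefficients. -/
noncomputable def augmentation (X : Type) : (X →₀ ℤ) →ₗ[ℤ] ℤ :=
  Finsupp.linearCombination ℤ fun _ => 1

theorem augmentation_single (x : X) (r : ℤ) : augmentation X (Finsupp.single x r) = r := by
  simp [augmentation]

theorem augmentation_mapDomain {X Y : Type} (f : X → Y) (u : X →₀ ℤ) :
    augmentation Y (Finsupp.mapDomain f u) = augmentation X u := by
  simp [augmentation, Finsupp.linearCombination_mapDomain, Function.comp_def]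

/-- If the chain complex of an acyclic one-dimensional complex with vertex set `X₀` and edge set
`X₁` consists of finitely generated free `ℤ[Γ]`-modules, then `Γ` is of type FP and its Euler
characteristic is that of the quotient graph. -/
theorem isTypeFP_and_homologicalEulerChar_of_free_action {X₁ X₀ Y₁ Y₀ : Type}
    [MulAction Γ X₁] [MulAction Γ X₀] [Finite Y₁] [Finite Y₀]
    (e₁ : Γ × Y₁ ≃ X₁) (he₁ : ∀ a b y, e₁ (a * b, y) = a • e₁ (b, y))
    (e₀ : Γ × Y₀ ≃ X₀) (he₀ : ∀ a b y, e₀ (a * b, y) = a • e₀ (b, y))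
    (d : (X₁ →₀ ℤ) →ₗ[ℤ] (X₀ →₀ ℤ))
    (hequiv : ∀ (γ : Γ) u, d (Finsupp.mapDomain (γ • ·) u) = Finsupp.mapDomain (γ • ·) (d u))
    (hd : Function.Injective d) [Nonempty X₀]
    (hdε : ∀ x, augmentation X₀ x = 0 ↔ ∃ y, d y = x) :
    IsTypeFP Γ ∧ homologicalEulerChar Γ = Nat.card Y₀ - Nat.card Y₁ := by
  let φ₁ := permEquiv e₁
  let φ₀ := permEquiv e₀
  let D : Rep.free ℤ Γ Y₁ ⟶ Rep.free ℤ Γ Y₀ :=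
    Rep.ofHom ⟨φ₀.symm.toLinearMap ∘ₗ d ∘ₗ φ₁.toLinearMap, fun γ => LinearMap.ext fun x => by
      apply φ₀.injective
      simp only [LinearMap.comp_apply, LinearEquiv.coe_coe, LinearEquiv.apply_symm_apply]
      rw [permEquiv_free e₁ he₁, hequiv, permEquiv_free e₀ he₀, LinearEquiv.apply_symm_apply]⟩
  let E : Rep.free ℤ Γ Y₀ ⟶ Rep.trivial ℤ Γ ℤ :=
    Rep.ofHom ⟨augmentation X₀ ∘ₗ φ₀.toLinearMap, fun γ => LinearMap.ext fun x => by
      simp only [LinearMap.comp_apply, LinearEquiv.coe_coe, Representation.isTrivial_def,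
        LinearMap.id_apply]
      rw [permEquiv_free e₀ he₀, augmentation_mapDomain]⟩
  refine isTypeFP_and_homologicalEulerChar_of_free D E ?_ ?_ ?_
  · exact φ₀.symm.injective.comp (hd.comp φ₁.injective)
  · intro r
    obtain ⟨x⟩ := ‹Nonempty X₀›
    refine ⟨φ₀.symm (Finsupp.single x r), ?_⟩
    change augmentation X₀ (φ₀ (φ₀.symm _)) = r
    rw [LinearEquiv.apply_symm_apply, augmentation_single]
  · intro x
    change augmentation X₀ (φ₀ x) = 0 ↔ ∃ y, φ₀.symm (d (φ₁ y)) = x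
    rw [hdε]
    constructor
    · rintro ⟨y, hy⟩
      exact ⟨φ₁.symm y, by rw [LinearEquiv.apply_symm_apply, hy, LinearEquiv.symm_apply_apply]⟩
    · rintro ⟨y, rfl⟩
      exact ⟨φ₁ y, by rw [LinearEquiv.apply_symm_apply]⟩

/-- Telescoping: `g ^ k - 1` is a multiple of `g - 1`. -/
theorem single_smul_sub_single_mem_range (g : Γ) (x : X) (r : ℤ) (k : ℕ) :
    Finsupp.single (g ^ k • x) r - Finsupp.single x r ∈
      LinearMap.range (Finsupp.lmapDomain ℤ ℤ (g • · : X → X) - LinearMap.id) := by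
  induction k with
  | zero => simp
  | succ k ih =>
    rw [← sub_add_sub_cancel _ (Finsupp.single (g ^ k • x) r)]
    refine add_mem ⟨Finsupp.single (g ^ k • x) r, ?_⟩ ih
    rw [LinearMap.sub_apply, LinearMap.id_apply, Finsupp.lmapDomain_apply,
      Finsupp.mapDomain_single, smul_smul, pow_succ']

/-- On a permutation module of a finite cyclic group, the kernel of the norm is the image of
`g - 1`. -/
theorem mem_range_of_sum_pow_eq_zero {g : Γ} (hg : IsOfFinOrder g) {u : X →₀ ℤ}
    (hu : ∑ i ∈ Finset.range (orderOf g), Finsupp.mapDomain (g ^ i • ·) u = 0) :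
    u ∈ LinearMap.range (Finsupp.lmapDomain ℤ ℤ (g • · : X → X) - LinearMap.id) := by
  -- `q` sends a point to a chosen representative of its `⟨g⟩`-orbit.
  let q : X → X := fun x => Quotient.out
    (Quotient.mk (MulAction.orbitRel (Subgroup.zpowers g) X) x)
  have hq (x : X) : ∃ k : ℕ, x = g ^ k • q x := by
    obtain ⟨⟨c, hc⟩, h⟩ := Quotient.exact (Quotient.out_eq
      (s := MulAction.orbitRel (Subgroup.zpowers g) X) (Quotient.mk _ x))
    rw [← hg.mem_powers_iff_mem_zpowers] at hc
    obtain ⟨k, rfl⟩ := hc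
    have hk : g ^ k • x = q x := h
    obtain ⟨m, hm⟩ := (hg.mem_powers_iff_mem_zpowers).2
      (inv_mem (Subgroup.pow_mem _ (Subgroup.mem_zpowers g) k))
    refine ⟨m, ?_⟩
    have hm' : g ^ m = (g ^ k)⁻¹ := hm
    rw [hm', ← hk, inv_smul_smul]
  have hqg (i : ℕ) : q ∘ (g ^ i • ·) = q := by
    funext x
    refine congrArg Quotient.out (Quotient.sound ?_)
    exact ⟨⟨g ^ i, Subgroup.pow_mem _ (Subgroup.mem_zpowers g) i⟩, rfl⟩
  -- Pushing the norm of `u` along `q` gives `orderOf g` times the pushforward of `u`, and the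
  -- module is torsion-free. Thus `u` equals `u` minus its pushforward, a combination of elements `g
  -- ^ k • y - y`.
  have hqu : Finsupp.mapDomain q u = 0 := by
    have h := congrArg (Finsupp.mapDomain q) hu
    rw [Finsupp.mapDomain_finsetSum, Finsupp.mapDomain_zero] at h
    simp only [← Finsupp.mapDomain_comp, hqg, Finset.sum_const, Finset.card_range] at h
    exact (smul_eq_zero.1 h).resolve_left hg.orderOf_pos.ne'
  suffices h : u - Finsupp.mapDomain q u ∈
      LinearMap.range (Finsupp.lmapDomain ℤ ℤ (g • · : X → X) - LinearMap.id) by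
    rwa [hqu, sub_zero] at h
  clear hu hqu
  induction u using Finsupp.induction_linear with
  | zero => simp
  | add u v hu hv =>
    rw [Finsupp.mapDomain_add, add_sub_add_comm]
    exact add_mem hu hv
  | single x r =>
    obtain ⟨k, hk⟩ := hq x
    rw [Finsupp.mapDomain_single]
    nth_rw 1 [hk]
    exact single_smul_sub_single_mem_range g (q x) r k

/-- The augmentation of an invariant element of a free permutation module of a finite group is
divisible by the order of the group. -/
theorem card_dvd_augmentation [Finite Γ] (h : IsFreeAction Γ X) {w : X →₀ ℤ}
    (hw : ∀ (γ : Γ) x, w (γ • x) = w x) : (Nat.card Γ : ℤ) ∣ augmentation X w := by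
  classical
  have := Fintype.ofFinite Γ
  -- In the coordinates `Γ × orbits` an invariant function depends only on the orbit, so its sum
  -- over each orbit is `|Γ|` times one value.
  let W := Finsupp.mapDomain h.prodOrbitsEquiv.symm w
  have hW (c : Γ) (y) : W (c, y) = W (1, y) := by
    have key (a : Γ) : W (a, y) = w (h.prodOrbitsEquiv (a, y)) := by
      conv_lhs => rw [← h.prodOrbitsEquiv.symm_apply_apply (a, y)]
      exact Finsupp.mapDomain_apply h.prodOrbitsEquiv.symm.injective _ _
    rw [key, key, ← mul_one c, h.prodOrbitsEquiv_mul, hw]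
  rw [← augmentation_mapDomain h.prodOrbitsEquiv.symm w]
  change _ ∣ augmentation _ W
  have hs : W.support ⊆ Finset.univ ×ˢ W.support.image Prod.snd := fun a ha => by
    simp only [Finset.mem_product, Finset.mem_univ, true_and]
    exact Finset.mem_image_of_mem _ ha
  rw [augmentation, Finsupp.linearCombination_apply, Finsupp.sum_of_support_subset _ hs _ (by simp),
    Finset.sum_product_right]
  refine Finset.dvd_sum fun y _ => ?_
  simp [hW, Nat.card_eq_fintype_card]

/-- A group element of finite order all of whose nontrivial powers act without fixed points on the
vertices of an acyclic one-dimensional complex is trivial. -/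
theorem eq_one_of_isOfFinOrder_of_acyclic {X₁ X₀ : Type} [MulAction Γ X₁]
    [MulAction Γ X₀] (h₀ : IsFreeAction Γ X₀)
    (d : (X₁ →₀ ℤ) →ₗ[ℤ] (X₀ →₀ ℤ))
    (hequiv : ∀ (γ : Γ) u, d (Finsupp.mapDomain (γ • ·) u) = Finsupp.mapDomain (γ • ·) (d u))
    (hd : Function.Injective d) [Nonempty X₀]
    (hdε : ∀ x, augmentation X₀ x = 0 ↔ ∃ y, d y = x) (g : Γ) (hg : IsOfFinOrder g) : g = 1 := by
  obtain ⟨x₀⟩ := ‹Nonempty X₀›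
  let e : X₀ →₀ ℤ := Finsupp.single x₀ 1
  obtain ⟨u, hu⟩ := (hdε (Finsupp.mapDomain (g • ·) e - e)).1 (by
    rw [map_sub, augmentation_mapDomain, sub_self])
  -- Since `d u = g e - e`, the boundary of the norm of `u` telescopes to zero.
  have hN : ∑ i ∈ Finset.range (orderOf g), Finsupp.mapDomain (g ^ i • ·) u = 0 := by
    apply hd
    rw [map_sum, map_zero]
    have (i : ℕ) : d (Finsupp.mapDomain (g ^ i • ·) u) =
        Finsupp.mapDomain (g ^ (i + 1) • ·) e - Finsupp.mapDomain (g ^ i • ·) e := by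
      rw [hequiv, hu, Finsupp.mapDomain_sub, ← Finsupp.mapDomain_comp]
      congr 2
      funext x
      simp [pow_succ, mul_smul]
    simp only [this]
    rw [Finset.sum_range_sub (fun i => Finsupp.mapDomain (g ^ i • · : X₀ → X₀) e),
      pow_orderOf_eq_one, pow_zero, sub_self]
  obtain ⟨v, hv⟩ := mem_range_of_sum_pow_eq_zero hg hN
  rw [LinearMap.sub_apply, LinearMap.id_apply, Finsupp.lmapDomain_apply] at hv
  -- With `u = g v - v`, correcting `e` by `d v` gives a `g`-invariant chain of augmentation `1`;
  -- freeness on vertices then makes the order of `g` divide `1`.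
  have hw : Finsupp.mapDomain (g • ·) (e - d v) = e - d v := by
    rw [Finsupp.mapDomain_sub, ← hequiv, eq_add_of_sub_eq hv, map_add, hu]
    abel
  have hεw : augmentation X₀ (e - d v) = 1 := by
    rw [map_sub, (hdε (d v)).2 ⟨v, rfl⟩, augmentation_single, sub_zero]
  have hfin : Finite (Subgroup.zpowers g) := hg.finite_zpowers
  have hdvd : (Nat.card (Subgroup.zpowers g) : ℤ) ∣ augmentation X₀ (e - d v) := by
    apply card_dvd_augmentation
    · intro γ x h
      exact Subtype.ext (h₀ γ x h)
    · rintro ⟨γ, hγ⟩ x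
      rw [← hg.mem_powers_iff_mem_zpowers] at hγ
      obtain ⟨k, rfl⟩ := hγ
      change (e - d v) (g ^ k • x) = (e - d v) x
      clear hγ
      induction k with
      | zero => simp
      | succ k ih =>
        rw [pow_succ', mul_smul, ← ih]
        conv_lhs => rw [← hw]
        exact Finsupp.mapDomain_apply (MulAction.injective g) _ _
  rw [hεw, Nat.card_zpowers] at hdvd
  rw [← orderOf_eq_one_iff]
  exact_mod_cast Int.eq_one_of_dvd_one (by positivity) hdvd

end FreeAction

/-! ### Star amalgams and their finite quotients. -/

/-- `G` is the amalgam of the groups `K j` along a star: for each `j`, the image of `N j` in `K j`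
under `a j` is identified with its image in `K o` under `b j`. -/
structure IsStarAmalgam {ι : Type} (o : ι) {N K : ι → Type} [∀ j, Group (N j)] [∀ j, Group (K j)]
    (a : ∀ j, N j →* K j) (b : ∀ j, N j →* K o) {G : Type} [Group G] (f : ∀ j, K j →* G) :
    Prop where
  base : ∀ x, a o x = b o x
  comm : ∀ j x, f j (a j x) = f o (b j x)
  closure_eq_top : ⨆ j, (f j).range = ⊤
  lift : ∀ (H : Type) [Group H] (h : ∀ j, K j →* H), (∀ j x, h j (a j x) = h o (b j x)) →
    ∃ φ : G →* H, ∀ j x, φ (f j x) = h j x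

/-- Free actions of a finite group on the same finite set are isomorphic. -/
theorem exists_perm_conj_of_free {N Ω : Type} [Group N] [Finite Ω]
    (α β : N →* Equiv.Perm Ω) (hα : ∀ n ω, α n ω = ω → n = 1) (hβ : ∀ n ω, β n ω = ω → n = 1) :
    ∃ σ : Equiv.Perm Ω, ∀ n ω, σ (α n ω) = β n (σ ω) := by
  rcases isEmpty_or_nonempty Ω with h | ⟨⟨ω₀⟩⟩
  · exact ⟨1, fun _ ω => h.elim ω⟩
  have hN : Finite N := Finite.of_injective (fun n => α n ω₀) fun m n hmn => by
    rw [← inv_mul_eq_one]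
    refine hα _ ω₀ ?_
    rw [map_mul, map_inv, Equiv.Perm.mul_apply, Equiv.Perm.inv_eq_iff_eq]
    exact hmn.symm
  let e (γ : N →* Equiv.Perm Ω) (hγ : ∀ n ω, γ n ω = ω → n = 1) :
      ∃ (Y : Type) (e : N × Y ≃ Ω), ∀ m n y, e (m * n, y) = γ m (e (n, y)) :=
    letI := MulAction.compHom Ω γ
    have h : IsFreeAction N Ω := hγ
    ⟨_, h.prodOrbitsEquiv, h.prodOrbitsEquiv_mul⟩
  obtain ⟨Y, eα, heα⟩ := e α hα
  obtain ⟨Z, eβ, heβ⟩ := e β hβ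
  have hY : Finite Y := Finite.of_injective (fun y => eα (1, y)) fun y z h => by
    simpa using h
  have hZ : Finite Z := Finite.of_injective (fun y => eβ (1, y)) fun y z h => by
    simpa using h
  -- Both actions have `|Ω| / |N|` orbits; matching the orbits gives the conjugating permutation.
  have hcard : Nat.card N * Nat.card Y = Nat.card N * Nat.card Z := by
    rw [← Nat.card_prod, ← Nat.card_prod, Nat.card_congr (eα.trans eβ.symm)]
  obtain ⟨s⟩ := Finite.card_eq.1 (Nat.eq_of_mul_eq_mul_left Nat.card_pos hcard)
  refine ⟨(eα.symm.trans ((Equiv.refl N).prodCongr s)).trans eβ, fun n ω => ?_⟩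
  obtain ⟨⟨m, y⟩, rfl⟩ := eα.surjective ω
  rw [← heα]
  simp [heβ]

namespace IsStarAmalgam

variable {ι : Type} {o : ι} {N K : ι → Type} [∀ j, Group (N j)] [∀ j, Group (K j)]
  {a : ∀ j, N j →* K j} {b : ∀ j, N j →* K o} {G : Type} [Group G] {f : ∀ j, K j →* G}

/-- Inverses need no case of their own, because each `(f j).range` is closed under them. -/
theorem induction (h : IsStarAmalgam o a b f) {P : G → Prop} (g : G) (one : P 1)
    (mul : ∀ g j x, P g → P (g * f j x)) : P g := by
  have hg : g ∈ Subgroup.closure (⋃ j, ((f j).range : Set G)) := by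
    rw [Subgroup.closure_iUnion]
    simp only [Subgroup.closure_eq, h.closure_eq_top, Subgroup.mem_top]
  induction hg using Subgroup.closure_induction_right with
  | one => exact one
  | mul_right x y hx hy ih =>
    obtain ⟨j, ⟨k, rfl⟩⟩ := Set.mem_iUnion.1 hy
    exact mul _ _ _ ih
  | mul_inv_cancel x y hx hy ih =>
    obtain ⟨j, ⟨k, rfl⟩⟩ := Set.mem_iUnion.1 hy
    rw [← map_inv]
    exact mul _ _ _ ih

/-- A homomorphism to a finite group that is injective on all the groups `K j`. -/
theorem exists_finite_quotient (h : IsStarAmalgam o a b f) [Finite ι] [∀ j, Finite (K j)]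
    (ha : ∀ j, Function.Injective (a j)) (hb : ∀ j, Function.Injective (b j)) :
    ∃ (Q : Type) (_ : Group Q) (_ : Finite Q) (φ : G →* Q),
      ∀ j, Function.Injective fun x => φ (f j x) := by
  classical
  -- Every `K j` acts freely on this one finite set, by left multiplication in its own coordinate.
  let Ω := ∀ j, K j
  let l (j : ι) : K j →* Equiv.Perm Ω := (MulAction.toPermHom Ω Ω).comp (MonoidHom.mulSingle K j)
  have hl (j : ι) (x : K j) (ω : Ω) (hx : l j x ω = ω) : x = 1 := by
    have h' : Pi.mulSingle j x * ω = ω := hx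
    rw [mul_eq_right] at h'
    simpa using h'
  have hσ (j : ι) : ∃ σ : Equiv.Perm Ω, (j = o → σ = 1) ∧
      ∀ n ω, σ (l o (b j n) ω) = l j (a j n) (σ ω) := by
    by_cases hj : j = o
    · subst hj
      exact ⟨1, fun _ => rfl, fun n ω => by simp [h.base]⟩
    · obtain ⟨σ, hσ⟩ := exists_perm_conj_of_free ((l o).comp (b j)) ((l j).comp (a j))
        (fun n ω hn => hb j ((hl _ _ _ hn).trans (map_one _).symm))
        (fun n ω hn => ha j ((hl _ _ _ hn).trans (map_one _).symm))
      exact ⟨σ, fun h => (hj h).elim, hσ⟩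
  choose σ hσo hσ using hσ
  -- Conjugation by `(σ j)⁻¹` makes the action of `K j` agree with that of `K o` on `N j`, and keeps
  -- it free.
  obtain ⟨φ, hφ⟩ := h.lift (Equiv.Perm Ω)
    (fun j => (MulAut.conj (σ j)⁻¹).toMonoidHom.comp (l j)) (fun j n => by
      ext1 ω
      simp [hσo o rfl, ← hσ j])
  refine ⟨Equiv.Perm Ω, inferInstance, inferInstance, φ, fun j x y hxy => ?_⟩
  simp only [hφ] at hxy
  have : l j x = l j y := (MulAut.conj (σ j)⁻¹).injective hxy
  rw [← inv_mul_eq_one]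
  refine hl j _ 1 ?_
  rw [map_mul, map_inv, this, inv_mul_cancel, Equiv.Perm.one_apply]

end IsStarAmalgam

/-! ### The Bass–Serre tree and its acyclicity. -/

namespace IsStarAmalgam

variable {ι : Type} {o : ι} {N K : ι → Type} [∀ j, Group (N j)] [∀ j, Group (K j)]
  {a : ∀ j, N j →* K j} {b : ∀ j, N j →* K o} {G : Type} [Group G] {f : ∀ j, K j →* G}

/-- The vertices of the tree of a star amalgam. -/
abbrev Vertex (f : ∀ j, K j →* G) : Type := Σ j, G ⧸ (f j).range

/-- The edges of the tree of a star amalgam. -/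
abbrev Edge (o : ι) (a : ∀ j, N j →* K j) (f : ∀ j, K j →* G) : Type :=
  Σ j : {j // j ≠ o}, G ⧸ ((f j).comp (a j)).range

theorem range_comp_le_range {A B : Type} [Group A] [Group B] (φ : B →* G) (ψ : A →* B) :
    (φ.comp ψ).range ≤ φ.range := by
  rintro _ ⟨x, rfl⟩
  exact ⟨ψ x, rfl⟩

/-- The outer end of an edge. -/
def Edge.outer (e : Edge o a f) : Vertex f :=
  ⟨e.1, Subgroup.quotientMapOfLE (range_comp_le_range _ _) e.2⟩

theorem range_comp_le (h : IsStarAmalgam o a b f) (j : ι) :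
    ((f j).comp (a j)).range ≤ (f o).range := by
  rintro _ ⟨x, rfl⟩
  exact ⟨b j x, (h.comm j x).symm⟩

/-- The end of an edge in the orbit of the central vertex. -/
def inner (h : IsStarAmalgam o a b f) (e : Edge o a f) : Vertex f :=
  ⟨o, Subgroup.quotientMapOfLE (h.range_comp_le e.1) e.2⟩

theorem outer_smul (g : G) (e : Edge o a f) : (g • e).outer = g • e.outer := by
  obtain ⟨j, x⟩ := e
  obtain ⟨x, rfl⟩ := QuotientGroup.mk_surjective x
  rfl

theorem inner_smul (h : IsStarAmalgam o a b f) (g : G) (e : Edge o a f) :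
    h.inner (g • e) = g • h.inner e := by
  obtain ⟨j, x⟩ := e
  obtain ⟨x, rfl⟩ := QuotientGroup.mk_surjective x
  rfl

/-- The boundary map of the tree of a star amalgam. -/
noncomputable def boundary (h : IsStarAmalgam o a b f) :
    (Edge o a f →₀ ℤ) →ₗ[ℤ] (Vertex f →₀ ℤ) :=
  Finsupp.lmapDomain ℤ ℤ Edge.outer - Finsupp.lmapDomain ℤ ℤ h.inner

theorem boundary_apply (h : IsStarAmalgam o a b f) (u : Edge o a f →₀ ℤ) :
    h.boundary u = Finsupp.mapDomain Edge.outer u - Finsupp.mapDomain h.inner u :=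
  rfl

theorem boundary_mapDomain_smul (h : IsStarAmalgam o a b f) (g : G) (u : Edge o a f →₀ ℤ) :
    h.boundary (Finsupp.mapDomain (g • ·) u) = Finsupp.mapDomain (g • ·) (h.boundary u) := by
  simp only [boundary_apply, Finsupp.mapDomain_sub, ← Finsupp.mapDomain_comp]
  congr 2
  · exact funext fun e => outer_smul g e
  · exact funext fun e => h.inner_smul g e

/-- This is connectedness: for `x` in `K j`, the central vertices at `g` and at `g * f j x` are both
joined to the vertex `g K j` (or coincide with it if `j = o`), and such steps reach all of `G`. -/
theorem single_sub_single_mem_range_boundary (h : IsStarAmalgam o a b f) (v : Vertex f) (r : ℤ) :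
    Finsupp.single v r - Finsupp.single ⟨o, ((1 : G) : G ⧸ (f o).range)⟩ r ∈
      LinearMap.range h.boundary := by
  have key (j : ι) (g : G) :
      Finsupp.single (⟨j, (g : G ⧸ (f j).range)⟩ : Vertex f) r -
        Finsupp.single ⟨o, (g : G ⧸ (f o).range)⟩ r ∈ LinearMap.range h.boundary := by
    by_cases hj : j = o
    · subst hj
      rw [sub_self]
      exact zero_mem _
    · refine ⟨Finsupp.single ⟨⟨j, hj⟩, (g : G ⧸ ((f j).comp (a j)).range)⟩ r, ?_⟩
      rw [boundary_apply, Finsupp.mapDomain_single, Finsupp.mapDomain_single]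
      rfl
  obtain ⟨j, g⟩ := v
  obtain ⟨g, rfl⟩ := QuotientGroup.mk_surjective g
  rw [← sub_add_sub_cancel _ (Finsupp.single ⟨o, (g : G ⧸ (f o).range)⟩ r)]
  refine add_mem (key j g) ?_
  induction g using h.induction with
  | one => simp
  | mul g j x ih =>
    rw [← sub_add_sub_cancel _ (Finsupp.single ⟨o, (g : G ⧸ (f o).range)⟩ r)]
    refine add_mem ?_ ih
    have h1 := sub_mem (key j g) (key j (g * f j x))
    have h2 : ((g * f j x : G) : G ⧸ (f j).range) = g :=
      QuotientGroup.mk_mul_of_mem g ⟨x, rfl⟩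
    rwa [h2, sub_sub_sub_cancel_left] at h1

/-- By connectedness, every vertex chain is its augmentation times the base vertex, modulo
boundaries. -/
theorem augmentation_eq_zero_iff (h : IsStarAmalgam o a b f) (x : Vertex f →₀ ℤ) :
    augmentation _ x = 0 ↔ ∃ y, h.boundary y = x := by
  constructor
  · intro hx
    have key (x : Vertex f →₀ ℤ) :
        x - Finsupp.single ⟨o, ((1 : G) : G ⧸ (f o).range)⟩ (augmentation _ x) ∈
          LinearMap.range h.boundary := by
      induction x using Finsupp.induction_linear with
      | zero => simp
      | add u v hu hv =>
        rw [map_add, Finsupp.single_add, add_sub_add_comm]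
        exact add_mem hu hv
      | single v r =>
        rw [augmentation_single]
        exact h.single_sub_single_mem_range_boundary v r
    simpa [hx] using key x
  · rintro ⟨y, rfl⟩
    rw [boundary_apply, map_sub, augmentation_mapDomain, augmentation_mapDomain, sub_self]

/-- The permutation action of a group on a permutation module. -/
noncomputable def permAction (G X : Type) [Group G] [MulAction G X] :
    G →* Equiv.Perm (X →₀ ℤ) where
  toFun g :=
    { toFun := Finsupp.mapDomain (g • ·)
      invFun := Finsupp.mapDomain (g⁻¹ • ·)
      left_inv := fun u => by
        rw [← Finsupp.mapDomain_comp]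
        simp only [Function.comp_def, inv_smul_smul]
        exact Finsupp.mapDomain_id
      right_inv := fun u => by
        rw [← Finsupp.mapDomain_comp]
        simp only [Function.comp_def, smul_inv_smul]
        exact Finsupp.mapDomain_id }
  map_one' := by
    ext1 u
    simp only [one_smul]
    exact Finsupp.mapDomain_id
  map_mul' g g' := by
    ext1 u
    simp [← Finsupp.mapDomain_comp, Function.comp_def, mul_smul]

theorem permAction_apply {G X : Type} [Group G] [MulAction G X] (g : G) (u : X →₀ ℤ) :
    permAction G X g u = Finsupp.mapDomain (g • ·) u :=
  rfl

/-- The boundary map of the tree is injective: the tree has no cycles. -/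
theorem boundary_injective (h : IsStarAmalgam o a b f) : Function.Injective h.boundary := by
  classical
  let L := permAction G (Edge o a f)
  have L_sub (g : G) (u v) : L g (u - v) = L g u - L g v := Finsupp.mapDomain_sub
  -- `e j` is the path from the base vertex to the vertex `K j`: a single edge, or empty for `j =
  -- o`.
  let e (j : ι) : Edge o a f →₀ ℤ :=
    if hj : j ≠ o then Finsupp.single ⟨⟨j, hj⟩, ((1 : G) : G ⧸ _)⟩ 1 else 0
  have e_o : e o = 0 := dif_neg (by simp)
  have e_fixed (j : ι) (x : N j) : L (f j (a j x)) (e j) = e j := by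
    by_cases hj : j ≠ o
    · have h1 : e j = Finsupp.single ⟨⟨j, hj⟩, ((1 : G) : G ⧸ ((f j).comp (a j)).range)⟩ 1 :=
        dif_pos hj
      rw [h1, permAction_apply, Finsupp.mapDomain_single]
      congr 1
      refine Sigma.ext rfl (heq_of_eq ?_)
      change ((f j (a j x) * 1 : G) : G ⧸ ((f j).comp (a j)).range) = _
      rw [QuotientGroup.eq]
      exact ⟨x⁻¹, by simp⟩
    · have h1 : e j = 0 := dif_neg hj
      rw [h1]
      exact Finsupp.mapDomain_zero (f := (f j (a j x) • · : Edge o a f → Edge o a f))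
  -- `K j` acts affinely with fixed point `e j`. As `N j` fixes `e j` linearly, on `N j` this is the
  -- linear action, which is how `K o` acts; so these actions glue to an affine action `α` of `G`
  -- with linear part `L`.
  let H (j : ι) : K j →* Equiv.Perm (Edge o a f →₀ ℤ) :=
    (MulAut.conj (Equiv.addLeft (e j))).toMonoidHom.comp (L.comp (f j))
  have H_apply (j : ι) (x : K j) (u) : H j x u = e j + L (f j x) (u - e j) := by
    simp [H, neg_add_eq_sub]
  obtain ⟨α, hα⟩ := h.lift _ H fun j x => by
    ext1 u
    rw [H_apply, H_apply, e_o, L_sub, e_fixed, h.comm, zero_add, sub_zero, add_sub_cancel]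
  have α_sub (g : G) : ∀ u v, α g u - α g v = L g (u - v) := by
    induction g using h.induction with
    | one => simp only [map_one, Equiv.Perm.one_apply, implies_true]
    | mul g j x ih =>
      intro u v
      rw [map_mul, map_mul, Equiv.Perm.mul_apply, Equiv.Perm.mul_apply, ih, hα, H_apply, H_apply,
        add_sub_add_left_eq_sub, ← L_sub, sub_sub_sub_cancel_right]
      rfl
  -- `R v` plays the role of the path from the base vertex to `v`. It is well defined because `K j`
  -- fixes `e j` under `α`.
  let R : Vertex f → (Edge o a f →₀ ℤ) := fun v =>
    Quotient.liftOn' v.2 (fun g => α g (e v.1)) fun g g' hg => by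
      rw [QuotientGroup.leftRel_apply] at hg
      obtain ⟨x, hx⟩ := hg
      rw [← mul_inv_cancel_left g g', ← hx, map_mul, Equiv.Perm.mul_apply, hα, H_apply, sub_self]
      rw [permAction_apply, Finsupp.mapDomain_zero, add_zero]
  -- The paths to the two ends of an edge differ by that edge: `α g (e j) - α g 0 = L g (e j)`.
  suffices hR : (Finsupp.linearCombination ℤ R) ∘ₗ h.boundary = LinearMap.id from
    Function.LeftInverse.injective (g := Finsupp.linearCombination ℤ R) (LinearMap.congr_fun hR)
  refine Finsupp.lhom_ext' fun ed => LinearMap.ext_ring ?_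
  obtain ⟨⟨j, hj⟩, g⟩ := ed
  obtain ⟨g, rfl⟩ := QuotientGroup.mk_surjective g
  have h1 : e j = Finsupp.single ⟨⟨j, hj⟩, ((1 : G) : G ⧸ ((f j).comp (a j)).range)⟩ 1 :=
    dif_pos hj
  simp only [LinearMap.comp_apply, Finsupp.lsingle_apply, boundary_apply, map_sub,
    Finsupp.mapDomain_single, Finsupp.linearCombination_single, one_smul, LinearMap.id_apply]
  change α g (e j) - α g (e o) = _
  rw [α_sub, e_o, sub_zero, h1, permAction_apply, Finsupp.mapDomain_single]
  congr 1
  refine Sigma.ext rfl (heq_of_eq ?_)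
  change ((g * 1 : G) : G ⧸ ((f j).comp (a j)).range) = _
  rw [mul_one]

end IsStarAmalgam

/-! ### Orbit counts for torsion-free subgroups of finite index. -/

/-- The stabilizer of `gA` is `gAg⁻¹`. -/
theorem isFreeAction_quotient {G : Type} [Group G] (Γ A : Subgroup G)
    (h : ∀ γ ∈ Γ, ∀ g : G, g⁻¹ * γ * g ∈ A → γ = 1) : IsFreeAction Γ (G ⧸ A) := by
  intro γ x hx
  obtain ⟨g, rfl⟩ := QuotientGroup.mk_surjective x
  have hx' : ((γ * g : G) : G ⧸ A) = g := hx
  rw [eq_comm, QuotientGroup.eq, ← mul_assoc] at hx'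
  exact Subtype.ext (h γ γ.2 g hx')

theorem isFreeAction_sigma {Γ ι : Type} [Group Γ] {X : ι → Type} [∀ j, MulAction Γ (X j)]
    (h : ∀ j, IsFreeAction Γ (X j)) : IsFreeAction Γ (Σ j, X j) := by
  rintro γ ⟨j, x⟩ hx
  exact h j γ x (eq_of_heq (Sigma.mk.inj hx).2)

/-- If `Γ` acts freely on `G ⧸ A`, then the number of orbits is `[G : Γ] / |A|`. -/
theorem exists_prod_equiv_quotient {G : Type} [Group G] (Γ A : Subgroup G) [Γ.FiniteIndex]
    (h : IsFreeAction Γ (G ⧸ A)) :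
    ∃ (Y : Type) (_ : Finite Y) (e : Γ × Y ≃ G ⧸ A),
      (∀ a b y, e (a * b, y) = a • e (b, y)) ∧ Nat.card Y * Nat.card A = Γ.index := by
  let Y := MulAction.orbitRel.Quotient Γ (G ⧸ A)
  let e : Γ × Y ≃ G ⧸ A := h.prodOrbitsEquiv
  have he : ∀ a b y, e (a * b, y) = a • e (b, y) := h.prodOrbitsEquiv_mul
  let s (y : Y) : G := (e (1, y)).out
  have hs (γ : Γ) (y : Y) : ((γ * s y : G) : G ⧸ A) = e (γ, y) := by
    rw [show e (γ, y) = γ • e (1, y) by rw [← he, mul_one]]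
    exact congrArg (γ • ·) (QuotientGroup.out_eq' (e (1, y)))
  -- Each coset `Γ g` equals `Γ s(y) c` for a unique orbit `y` and, by freeness, a unique `c` in
  -- `A`.
  let F : Y × A → Quotient (QuotientGroup.rightRel Γ) := fun x => Quotient.mk _ (s x.1 * x.2)
  have hF : Function.Bijective F := by
    constructor
    · rintro ⟨y, c⟩ ⟨z, c'⟩ hyz
      obtain ⟨γ, hγ⟩ := Quotient.exact hyz
      have hγ' : (γ : G) * (s z * c') = s y * c := hγ
      have h1 : e (1, y) = e (γ, z) := by
        rw [← hs, ← hs, QuotientGroup.eq]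
        have : ((1 : Γ) * s y)⁻¹ * (γ * s z : G) = c * (c' : G)⁻¹ := by
          rw [OneMemClass.coe_one, one_mul, inv_mul_eq_iff_eq_mul, ← mul_assoc, ← hγ']
          group
        rw [this]
        exact mul_mem c.2 (inv_mem c'.2)
      obtain ⟨h2, rfl⟩ := Prod.ext_iff.1 (e.injective h1)
      dsimp only at h2
      subst h2
      rw [OneMemClass.coe_one, one_mul, mul_right_inj] at hγ'
      rw [Subtype.ext hγ']
    · intro q
      obtain ⟨g, rfl⟩ := Quotient.exists_rep q
      obtain ⟨⟨γ, y⟩, hγ⟩ := e.surjective (g : G ⧸ A)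
      rw [← hs, QuotientGroup.eq] at hγ
      refine ⟨(y, ⟨_, hγ⟩), Quotient.sound ⟨γ⁻¹, ?_⟩⟩
      change (γ⁻¹ : G) * g = s y * ((γ * s y)⁻¹ * g)
      group
  have hcard : Nat.card Y * Nat.card A = Γ.index := by
    rw [← Nat.card_prod, Nat.card_congr (Equiv.ofBijective F hF),
      Nat.card_congr (QuotientGroup.quotientRightRelEquivQuotientLeftRel Γ)]
    rfl
  -- An infinite `Y` would have `Nat.card Y = 0`, but the index is nonzero.
  have hY : Finite Y := by
    apply Nat.finite_of_card_ne_zero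
    intro h0
    rw [h0, zero_mul] at hcard
    exact Subgroup.FiniteIndex.index_ne_zero hcard.symm
  exact ⟨Y, hY, e, he, hcard⟩

theorem exists_prod_equiv_sigma {Γ ι : Type} [Group Γ] {X : ι → Type} [∀ j, MulAction Γ (X j)]
    {Y : ι → Type} (e : ∀ j, Γ × Y j ≃ X j) (he : ∀ j a b y, e j (a * b, y) = a • e j (b, y)) :
    ∃ E : Γ × (Σ j, Y j) ≃ Σ j, X j, ∀ a b y, E (a * b, y) = a • E (b, y) :=
  ⟨{ toFun := fun x => ⟨x.2.1, e x.2.1 (x.1, x.2.2)⟩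
     invFun := fun x => (((e x.1).symm x.2).1, ⟨x.1, ((e x.1).symm x.2).2⟩)
     left_inv := fun ⟨γ, ⟨j, y⟩⟩ => by simp
     right_inv := fun ⟨j, x⟩ => by simp },
    fun a b ⟨j, y⟩ => congrArg (Sigma.mk j) (he j a b y)⟩

namespace IsStarAmalgam

variable {ι : Type} {o : ι} {N K : ι → Type} [∀ j, Group (N j)] [∀ j, Group (K j)]
  {a : ∀ j, N j →* K j} {b : ∀ j, N j →* K o} {G : Type} [Group G] {f : ∀ j, K j →* G}

theorem nonempty_vertex (o : ι) (f : ∀ j, K j →* G) : Nonempty (Vertex f) :=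
  ⟨⟨o, ((1 : G) : G ⧸ _)⟩⟩

/-- A finite quotient already separates the elements of `K j`, so no normal form is needed. -/
theorem injective [Finite ι] [∀ j, Finite (K j)] (h : IsStarAmalgam o a b f)
    (ha : ∀ j, Function.Injective (a j)) (hb : ∀ j, Function.Injective (b j)) (j : ι) :
    Function.Injective (f j) := by
  obtain ⟨Q, _, _, φ, hφ⟩ := h.exists_finite_quotient ha hb
  exact Function.Injective.of_comp (f := φ) (hφ j)

/-- The kernel of the finite quotient meets every conjugate of each `K j` trivially, hence acts
freely on the vertices of the tree, which excludes torsion. -/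
theorem exists_torsionFree [Finite ι] [∀ j, Finite (K j)] (h : IsStarAmalgam o a b f)
    (ha : ∀ j, Function.Injective (a j)) (hb : ∀ j, Function.Injective (b j)) :
    ∃ Γ : Subgroup G, Γ.FiniteIndex ∧ ∀ g : Γ, IsOfFinOrder g → g = 1 := by
  obtain ⟨Q, _, _, φ, hφ⟩ := h.exists_finite_quotient ha hb
  refine ⟨φ.ker, inferInstance, ?_⟩
  have h₀ : IsFreeAction φ.ker (Vertex f) := isFreeAction_sigma fun j =>
    isFreeAction_quotient _ _ fun γ hγ g ⟨x, hx⟩ => by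
      have hx1 : x = 1 := hφ j (by simp [hx, MonoidHom.mem_ker.1 hγ])
      rw [hx1, map_one, eq_comm, mul_assoc, inv_mul_eq_one] at hx
      exact (mul_eq_right.1 hx.symm)
  have := nonempty_vertex o f
  exact eq_one_of_isOfFinOrder_of_acyclic h₀ h.boundary
    (fun γ u => h.boundary_mapDomain_smul γ u) h.boundary_injective h.augmentation_eq_zero_iff

/-- Stabilizers of cosets are conjugates of a finite group, so they consist of torsion elements. -/
theorem isFreeAction_of_torsionFree {A : Type} [Group A] [Finite A] (φ : A →* G) {Γ : Subgroup G}
    (hΓ : ∀ g : Γ, IsOfFinOrder g → g = 1) : IsFreeAction Γ (G ⧸ φ.range) := by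
  refine isFreeAction_quotient _ _ fun γ hγ g ⟨x, hx⟩ => ?_
  have h1 : IsOfFinOrder (g⁻¹ * γ * g) := hx ▸ φ.isOfFinOrder (isOfFinOrder_of_finite x)
  have h2 : IsOfFinOrder γ := by
    have := (MulAut.conj g).toMonoidHom.isOfFinOrder h1
    simpa [mul_assoc] using this
  exact congrArg Subtype.val (hΓ ⟨γ, hγ⟩ (Submonoid.isOfFinOrder_coe.1 h2))

/-- The rational Euler characteristic of a star amalgam of finite groups. -/
theorem hasRationalEulerChar [Fintype ι] [DecidableEq ι] [∀ j, Finite (K j)]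
    (h : IsStarAmalgam o a b f)
    (ha : ∀ j, Function.Injective (a j)) (hb : ∀ j, Function.Injective (b j)) :
    HasRationalEulerChar G (∑ j, 1 / (Nat.card (K j) : ℚ) -
      ∑ j ∈ Finset.univ.filter (fun j => j ≠ o), 1 / (Nat.card (N j) : ℚ)) := by
  refine ⟨h.exists_torsionFree ha hb, fun Γ hΓ htf => ?_⟩
  have hN (j : ι) : Finite (N j) := Finite.of_injective _ (ha j)
  choose Y₀ hY₀ e₀ he₀ hc₀ using fun j : ι =>
    exists_prod_equiv_quotient Γ (f j).range (isFreeAction_of_torsionFree (f j) htf)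
  choose Y₁ hY₁ e₁ he₁ hc₁ using fun j : {j // j ≠ o} =>
    exists_prod_equiv_quotient Γ ((f j).comp (a j)).range
      (isFreeAction_of_torsionFree ((f j).comp (a j)) htf)
  obtain ⟨E₀, hE₀⟩ := exists_prod_equiv_sigma e₀ he₀
  obtain ⟨E₁, hE₁⟩ := exists_prod_equiv_sigma e₁ he₁
  have := nonempty_vertex o f
  obtain ⟨hFP, hχ⟩ := isTypeFP_and_homologicalEulerChar_of_free_action E₁ hE₁ E₀ hE₀ h.boundary
    (fun γ u => h.boundary_mapDomain_smul γ u) h.boundary_injective h.augmentation_eq_zero_iff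
  refine ⟨hFP, ?_⟩
  have hi : (Γ.index : ℚ) ≠ 0 := Nat.cast_ne_zero.2 hΓ.index_ne_zero
  have hinj := h.injective ha hb
  -- After multiplication by the index, the summands are the numbers of orbits of each type.
  rw [hχ, Nat.card_sigma, Nat.card_sigma, eq_div_iff hi, sub_mul, Finset.sum_mul, Finset.sum_mul]
  push_cast
  congr 1
  · refine Finset.sum_congr rfl fun j _ => ?_
    have hK : (Nat.card (K j) : ℚ) ≠ 0 := Nat.cast_ne_zero.2 Nat.card_pos.ne'
    rw [← hc₀ j, ← Nat.card_congr (MonoidHom.ofInjective (hinj j)).toEquiv]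
    push_cast
    field_simp
  · rw [← Finset.sum_subtype_eq_sum_filter, Finset.subtype_univ]
    refine Finset.sum_congr rfl fun j _ => ?_
    have hK : (Nat.card (N j) : ℚ) ≠ 0 := Nat.cast_ne_zero.2 Nat.card_pos.ne'
    have hji : Function.Injective ((f j).comp (a j)) := (hinj j).comp (ha j)
    rw [← hc₁ j, ← Nat.card_congr (MonoidHom.ofInjective hji).toEquiv]
    push_cast
    field_simp

end IsStarAmalgam

/-! ### Groups generated by two finite subgroups with a common subgroup of index two. -/

theorem isVirtuallyCyclic_of_finite (G : Type) [Group G] [Finite G] : IsVirtuallyCyclic G :=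
  ⟨⊥, inferInstance, inferInstance⟩

section Dihedral

variable {G : Type} [Group G] {A N : Subgroup G}

theorem index_subgroupOf_eq_two [Finite N] (hNA : N ≤ A) (hA : Nat.card A = 2 * Nat.card N) :
    (N.subgroupOf A).index = 2 := by
  have h := (N.subgroupOf A).card_mul_index
  rw [hA, Nat.card_congr (Subgroup.subgroupOfEquivOfLe hNA).toEquiv, mul_comm] at h
  exact Nat.eq_of_mul_eq_mul_right Nat.card_pos h

theorem conj_mem_of_card_eq_two_mul [Finite N] (hNA : N ≤ A) (hA : Nat.card A = 2 * Nat.card N)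
    {x n : G} (hx : x ∈ A) (hn : n ∈ N) : x * n * x⁻¹ ∈ N := by
  have := Subgroup.normal_of_index_eq_two (index_subgroupOf_eq_two hNA hA)
  exact this.conj_mem ⟨n, hNA hn⟩ hn ⟨x, hx⟩

theorem mul_mem_of_card_eq_two_mul [Finite N] (hNA : N ≤ A) (hA : Nat.card A = 2 * Nat.card N)
    {x y : G} (hx : x ∈ A) (hy : y ∈ A) (hxN : x ∉ N) (hyN : y ∉ N) : x * y ∈ N :=
  (Subgroup.mul_mem_iff_of_index_two (index_subgroupOf_eq_two hNA hA)
    (a := ⟨x, hx⟩) (b := ⟨y, hy⟩)).2 (iff_of_false hxN hyN)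

theorem exists_notMem_of_card_eq_two_mul [Finite N] (hA : Nat.card A = 2 * Nat.card N) :
    ∃ x ∈ A, x ∉ N := by
  by_contra! h
  have h1 := Subgroup.card_le_of_le (show A ≤ N from h)
  have h2 : 0 < Nat.card N := Nat.card_pos
  omega

/-- A group generated by two subgroups that have a common finite subgroup of index two is
virtually cyclic. -/
theorem isVirtuallyCyclic_of_card_eq_two_mul {B : Subgroup G} [Finite N] (hNA : N ≤ A)
    (hNB : N ≤ B) (hA : Nat.card A = 2 * Nat.card N) (hB : Nat.card B = 2 * Nat.card N)
    (hAB : A ⊔ B = ⊤) : IsVirtuallyCyclic G := by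
  obtain ⟨s, hsA, hsN⟩ := exists_notMem_of_card_eq_two_mul hA
  obtain ⟨t, htB, htN⟩ := exists_notMem_of_card_eq_two_mul hB
  -- `N` is normal in `G`, and modulo `N` the group is generated by the involutions `s` and `t`, as
  -- a dihedral group is. Right multiplication by an element of `A` or `B` outside `N` swaps the two
  -- forms.
  have key (g : G) : ∃ k : ℤ, ∃ n ∈ N, g = (s * t) ^ k * n ∨ g = (s * t) ^ k * s * n := by
    have hg : g ∈ Subgroup.closure (A ∪ B : Set G) := by
      rw [Subgroup.closure_union, Subgroup.closure_eq, Subgroup.closure_eq, hAB]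
      exact Subgroup.mem_top g
    have step (g x : G) (hx : x ∈ (A ∪ B : Set G)) :
        (∃ k : ℤ, ∃ n ∈ N, g = (s * t) ^ k * n ∨ g = (s * t) ^ k * s * n) →
        ∃ k : ℤ, ∃ n ∈ N, g * x = (s * t) ^ k * n ∨ g * x = (s * t) ^ k * s * n := by
      rintro ⟨k, n, hn, hg⟩
      by_cases hxN : x ∈ N
      · exact ⟨k, n * x, mul_mem hn hxN, hg.imp (fun h => by rw [h, mul_assoc])
          (fun h => by rw [h, mul_assoc _ n])⟩
      rcases hx with hx | hx
      · have h1 : s⁻¹ * x ∈ N := mul_mem_of_card_eq_two_mul hNA hA (inv_mem hsA) hx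
          (fun h => hsN (by simpa using inv_mem h)) hxN
        have h2 : s⁻¹ * n * s ∈ N := by
          simpa using conj_mem_of_card_eq_two_mul hNA hA (inv_mem hsA) hn
        have h3 : s * s ∈ N := mul_mem_of_card_eq_two_mul hNA hA hsA hsA hsN hsN
        rcases hg with rfl | rfl
        · exact ⟨k, s⁻¹ * n * s * (s⁻¹ * x), mul_mem h2 h1, Or.inr (by group)⟩
        · exact ⟨k, s * s * (s⁻¹ * n * s * (s⁻¹ * x)), mul_mem h3 (mul_mem h2 h1),
            Or.inl (by simp only [mul_assoc, mul_inv_cancel_left])⟩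
      · have h1 : t⁻¹ * x ∈ N := mul_mem_of_card_eq_two_mul hNB hB (inv_mem htB) hx
          (fun h => htN (by simpa using inv_mem h)) hxN
        have h2 : t⁻¹ * n * t ∈ N := by
          simpa using conj_mem_of_card_eq_two_mul hNB hB (inv_mem htB) hn
        have h3 : t * t ∈ N := mul_mem_of_card_eq_two_mul hNB hB htB htB htN htN
        rcases hg with rfl | rfl
        · refine ⟨k - 1, t * t * (t⁻¹ * n * t * (t⁻¹ * x)), mul_mem h3 (mul_mem h2 h1),
            Or.inr ?_⟩
          rw [zpow_sub_one]
          simp only [mul_assoc, mul_inv_rev, mul_inv_cancel_left, inv_mul_cancel_left]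
        · refine ⟨k + 1, t⁻¹ * n * t * (t⁻¹ * x), mul_mem h2 h1, Or.inl ?_⟩
          rw [zpow_add_one]
          simp only [mul_assoc, mul_inv_cancel_left]
    induction hg using Subgroup.closure_induction_right with
    | one => exact ⟨0, 1, one_mem _, Or.inl (by simp)⟩
    | mul_right x _ y hy ih => exact step x y hy ih
    | mul_inv_cancel x _ y hy ih =>
      exact step x y⁻¹ (hy.imp (fun h => A.inv_mem h) (fun h => B.inv_mem h)) ih
  refine ⟨Subgroup.zpowers (s * t), ?_, inferInstance⟩
  -- The normal form is applied to `g⁻¹`, so that inverting moves the power of `s * t` to the right.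
  let F : N ⊕ N → G ⧸ Subgroup.zpowers (s * t) :=
    Sum.elim (fun n => ((n⁻¹ : G) : G ⧸ _)) (fun n => (((s * n)⁻¹ : G) : G ⧸ _))
  have hF : Function.Surjective F := by
    intro q
    obtain ⟨g, rfl⟩ := QuotientGroup.mk_surjective q
    obtain ⟨k, n, hn, h | h⟩ := key g⁻¹
    · refine ⟨Sum.inl ⟨n, hn⟩, QuotientGroup.eq.2 ⟨-k, ?_⟩⟩
      rw [inv_eq_iff_eq_inv] at h
      simp [h]
    · refine ⟨Sum.inr ⟨n, hn⟩, QuotientGroup.eq.2 ⟨-k, ?_⟩⟩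
      rw [inv_eq_iff_eq_inv] at h
      simp [h, mul_assoc]
  have := Finite.of_surjective F hF
  exact Subgroup.finiteIndex_of_finite_quotient

end Dihedral

/-! ### Nonnegative Euler characteristic forces virtually cyclic. -/

/-- The contribution `1 / n - 1 / (n * i)` of an edge to the Euler characteristic, as a multiple of
`1 / (n * m)`. -/
theorem one_div_sub_one_div_mul {n i : ℕ} (m : ℕ) (hn : n ≠ 0) (hi : i ≠ 0) (hm : m ≠ 0) :
    1 / (n : ℚ) - 1 / ((n * i : ℕ) : ℚ) = (((i : ℚ) - 1) * m / i) * (1 / ((n * m : ℕ) : ℚ)) := by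
  have h1 : (n : ℚ) ≠ 0 := Nat.cast_ne_zero.2 hn
  have h2 : (i : ℚ) ≠ 0 := Nat.cast_ne_zero.2 hi
  have h3 : (m : ℚ) ≠ 0 := Nat.cast_ne_zero.2 hm
  push_cast
  field_simp

/-- The term is `(1 - 1/i) m`, smallest at `i = 2`, `m = 1`. This bound and the next two lemmas list
the small cases. -/
theorem half_le_sub_one_mul_div {i m : ℕ} (hi : 2 ≤ i) (hm : m ≠ 0) :
    (1 / 2 : ℚ) ≤ ((i : ℚ) - 1) * m / i := by
  have h1 : (2 : ℚ) ≤ i := by exact_mod_cast hi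
  have h2 : (1 : ℚ) ≤ m := by exact_mod_cast Nat.one_le_iff_ne_zero.2 hm
  rw [div_le_div_iff₀ two_pos (by linarith)]
  nlinarith

theorem eq_of_sub_one_mul_div_le_half {i m : ℕ} (hi : 2 ≤ i) (hm : m ≠ 0)
    (h : ((i : ℚ) - 1) * m / i ≤ 1 / 2) : m = 1 ∧ i = 2 := by
  have h1 : (2 : ℚ) ≤ i := by exact_mod_cast hi
  have h2 : (1 : ℚ) ≤ m := by exact_mod_cast Nat.one_le_iff_ne_zero.2 hm
  rw [div_le_div_iff₀ (by linarith) two_pos] at h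
  have h3 : (i : ℚ) = 2 := by nlinarith
  have h4 : (m : ℚ) = 1 := by nlinarith
  exact ⟨by exact_mod_cast h4, by exact_mod_cast h3⟩

theorem eq_of_sub_one_mul_div_le_one {i m : ℕ} (hi : 2 ≤ i) (hm : m ≠ 0)
    (h : ((i : ℚ) - 1) * m / i ≤ 1) : m = 1 ∨ m = 2 ∧ i = 2 := by
  have h1 : (2 : ℚ) ≤ i := by exact_mod_cast hi
  rw [div_le_one (by linarith)] at h
  rcases eq_or_ne m 1 with hm1 | hm1
  · exact Or.inl hm1
  have h2 : (2 : ℚ) ≤ m := by exact_mod_cast (by omega : 2 ≤ m)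
  have h3 : (i : ℚ) = 2 := by nlinarith
  have h4 : (m : ℚ) = 2 := by nlinarith
  exact Or.inr ⟨by exact_mod_cast h4, by exact_mod_cast h3⟩

namespace IsStarAmalgam

variable {ι : Type} {o : ι} {N K : ι → Type} [∀ j, Group (N j)] [∀ j, Group (K j)]
  {a : ∀ j, N j →* K j} {b : ∀ j, N j →* K o} {G : Type} [Group G] {f : ∀ j, K j →* G}

/-- Used to collapse edges with `K j = N j`, which contribute no new generators. -/
theorem range_le_of_card_eq [∀ j, Finite (K j)]
    (ha : ∀ j, Function.Injective (a j)) {j : ι} (hj : Nat.card (K j) = Nat.card (N j)) :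
    (f j).range ≤ ((f j).comp (a j)).range := by
  rintro _ ⟨x, rfl⟩
  have hN : Finite (N j) := Finite.of_injective _ (ha j)
  obtain ⟨y, rfl⟩ := ((Nat.bijective_iff_injective_and_card (a j)).2 ⟨ha j, hj.symm⟩).2 x
  exact ⟨y, rfl⟩

/-- A star amalgam of finite groups with nonnegative Euler characteristic is virtually cyclic. -/
theorem isVirtuallyCyclic_of_nonneg [Fintype ι] [DecidableEq ι] [∀ j, Finite (K j)]
    (h : IsStarAmalgam o a b f)
    (ha : ∀ j, Function.Injective (a j)) (hb : ∀ j, Function.Injective (b j))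
    (hχ : 0 ≤ ∑ j, 1 / (Nat.card (K j) : ℚ) -
      ∑ j ∈ Finset.univ.filter (fun j => j ≠ o), 1 / (Nat.card (N j) : ℚ)) :
    IsVirtuallyCyclic G := by
  have hN (j : ι) : Finite (N j) := Finite.of_injective _ (ha j)
  have hn (j : ι) : Nat.card (N j) ≠ 0 := Nat.card_pos.ne'
  choose i hi using fun j => Subgroup.card_dvd_of_injective (a j) (ha j)
  choose m hm using fun j => Subgroup.card_dvd_of_injective (b j) (hb j)
  have hi0 (j : ι) : i j ≠ 0 := fun h0 => (Nat.card_pos (α := K j)).ne' (by rw [hi, h0, mul_zero])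
  have hm0 (j : ι) : m j ≠ 0 := fun h0 => (Nat.card_pos (α := K o)).ne' (by rw [hm j, h0, mul_zero])
  have hinj := h.injective ha hb
  have hfK (j : ι) : Finite (f j).range := Finite.of_surjective _ (f j).rangeRestrict_surjective
  have hfN (j : ι) : Finite ((f j).comp (a j)).range :=
    Finite.of_surjective _ ((f j).comp (a j)).rangeRestrict_surjective
  have hcardK (j : ι) : Nat.card (f j).range = Nat.card (N j) * i j := by
    rw [← hi, Nat.card_congr (MonoidHom.ofInjective (hinj j)).toEquiv]
  have hcardN (j : ι) : Nat.card ((f j).comp (a j)).range = Nat.card (N j) :=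
    (Nat.card_congr (MonoidHom.ofInjective ((hinj j).comp (ha j) :
      Function.Injective ((f j).comp (a j)))).toEquiv).symm
  have hcardO (j : ι) : Nat.card (f o).range = Nat.card (N j) * m j := by
    rw [← hm, Nat.card_congr (MonoidHom.ofInjective (hinj o)).toEquiv]
  have hko : (0 : ℚ) < 1 / (Nat.card (K o) : ℚ) :=
    one_div_pos.2 (Nat.cast_pos.2 Nat.card_pos)
  have hle_inner (j : ι) : ((f j).comp (a j)).range ≤ (f o).range := h.range_comp_le j
  have hle_outer (j : ι) : ((f j).comp (a j)).range ≤ (f j).range := range_comp_le_range _ _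
  -- `J` is the set of edges that do not collapse.
  let J : Finset ι := Finset.univ.filter fun j => j ≠ o ∧ i j ≠ 1
  -- This is the hypothesis `hχ` divided by `1 / |K o|`, using `|K o| = |N j| m j`.
  have hJ : ∑ j ∈ J, (((i j : ℚ) - 1) * m j / i j) ≤ 1 := by
    have e1 : ∑ j ∈ Finset.univ.filter (fun j => j ≠ o), (1 / (Nat.card (N j) : ℚ) -
        1 / (Nat.card (K j) : ℚ)) =
        ∑ j ∈ J, (((i j : ℚ) - 1) * m j / i j) * (1 / (Nat.card (K o) : ℚ)) := by
      have : J = (Finset.univ.filter (fun j => j ≠ o)).filter (fun j => i j ≠ 1) := by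
        rw [Finset.filter_filter]
      rw [this, Finset.sum_filter (fun j => i j ≠ 1)]
      refine Finset.sum_congr rfl fun j _ => ?_
      rw [hi j]
      split_ifs with hj
      · rw [one_div_sub_one_div_mul (m j) (hn j) (hi0 j) (hm0 j), ← hm j]
      · rw [not_not.1 hj, mul_one, sub_self]
    rw [← Finset.sum_mul, Finset.sum_sub_distrib] at e1
    have e2 := Finset.add_sum_erase Finset.univ (fun j => 1 / (Nat.card (K j) : ℚ))
      (Finset.mem_univ o)
    rw [← Finset.filter_ne'] at e2
    refine le_of_mul_le_mul_right ?_ hko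
    rw [one_mul]
    linarith
  have hi2 : ∀ j ∈ J, 2 ≤ i j := fun j hj => by
    have := (Finset.mem_filter.1 hj).2.2
    have := hi0 j
    omega
  have hJ2 : ∀ j ∈ J, (1 / 2 : ℚ) ≤ ((i j : ℚ) - 1) * m j / i j :=
    fun j hj => half_le_sub_one_mul_div (hi2 j hj) (hm0 j)
  have hsup (H : Subgroup G) (ho : (f o).range ≤ H) (hH : ∀ j ∈ J, (f j).range ≤ H) : H = ⊤ := by
    rw [eq_top_iff, ← h.closure_eq_top, iSup_le_iff]
    intro j
    by_cases hj : j ∈ J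
    · exact hH j hj
    by_cases hjo : j = o
    · rwa [hjo]
    have hij : i j = 1 := by
      by_contra hij
      exact hj (Finset.mem_filter.2 ⟨Finset.mem_univ _, hjo, hij⟩)
    exact ((range_le_of_card_eq ha (by rw [hi, hij, mul_one])).trans (hle_inner j)).trans ho
  have hfin (j : ι) (htop : (f j).range = ⊤) : IsVirtuallyCyclic G := by
    have : Finite G := Finite.of_surjective (f j) (MonoidHom.range_eq_top.1 htop)
    exact isVirtuallyCyclic_of_finite G
  have hinner (j : ι) (hj : m j = 1) : (f o).range = ((f j).comp (a j)).range :=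
    (Subgroup.eq_of_le_of_card_ge (hle_inner j) (by rw [hcardO j, hcardN, hj, mul_one])).symm
  have hcard : J.card ≤ 2 := by
    have := (Finset.card_nsmul_le_sum J _ _ hJ2).trans hJ
    rw [nsmul_eq_mul] at this
    have : (J.card : ℚ) ≤ 2 := by linarith
    exact_mod_cast this
  -- No edge: `G` is the image of `K o`. One edge: either `m = 1`, so `K o` lies in `K j` and `G` is
  -- finite, or `m = i = 2` and `N j` has index two in both groups. Two edges: equality in both
  -- bounds, so `K o` has index two in `K j` and in `K l`.
  interval_cases hc : J.card
  · rw [Finset.card_eq_zero] at hc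
    exact hfin o (hsup _ le_rfl (by simp [hc]))
  · obtain ⟨j, hj⟩ := Finset.card_eq_one.1 hc
    rw [hj] at hJ hi2
    rw [Finset.sum_singleton] at hJ
    rcases eq_of_sub_one_mul_div_le_one (hi2 j (by simp)) (hm0 j) hJ with hmj | ⟨hmj, hij⟩
    · refine hfin j (hsup _ ((hinner j hmj).le.trans (hle_outer j)) ?_)
      simp [hj]
    · refine isVirtuallyCyclic_of_card_eq_two_mul (hle_inner j) (hle_outer j)
        (by rw [hcardO j, hcardN, hmj, mul_comm]) (by rw [hcardK, hcardN, hij, mul_comm])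
        (hsup _ le_sup_left ?_)
      simp [hj]
  · obtain ⟨j, l, hjl, hj⟩ := Finset.card_eq_two.1 hc
    rw [hj] at hJ hi2 hJ2
    rw [Finset.sum_pair hjl] at hJ
    have hj2 := hJ2 j (by simp)
    have hl2 := hJ2 l (by simp)
    obtain ⟨hmj, hij⟩ := eq_of_sub_one_mul_div_le_half (hi2 j (by simp)) (hm0 j) (by linarith)
    obtain ⟨hml, hil⟩ := eq_of_sub_one_mul_div_le_half (hi2 l (by simp)) (hm0 l) (by linarith)
    refine isVirtuallyCyclic_of_card_eq_two_mul (N := (f o).range) (A := (f j).range)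
      (B := (f l).range) ((hinner j hmj).le.trans (hle_outer j))
      ((hinner l hml).le.trans (hle_outer l))
      (by rw [hcardK, hcardO j, hmj, hij, mul_one, mul_comm])
      (by rw [hcardK, hcardO l, hml, hil, mul_one, mul_comm])
      (hsup _ (((hinner j hmj).le.trans (hle_outer j)).trans le_sup_left) ?_)
    simp [hj]

end IsStarAmalgam

/-! ### The amalgam model as a star amalgam, and the denominator. -/

theorem CoprodI.iSup_range_mk'_eq_top {ι : Type} {K : ι → Type} [∀ j, Group (K j)]
    (R : Subgroup (Monoid.CoprodI K)) [R.Normal] :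
    ⨆ j, ((QuotientGroup.mk' R).comp (Monoid.CoprodI.of (M := K) (i := j))).range = ⊤ := by
  rw [eq_top_iff]
  rintro x -
  obtain ⟨x, rfl⟩ := QuotientGroup.mk'_surjective R x
  induction x using Monoid.CoprodI.induction_on with
  | one => exact one_mem _
  | of j x => exact Subgroup.mem_iSup_of_mem j ⟨x, rfl⟩
  | mul x y hx hy =>
    rw [map_mul]
    exact mul_mem hx hy

namespace AmalgamModel

variable {p : ℕ} {S : Type} [Group S] {F : FusionSystem S}

/-- The canonical homomorphism from `K j` to the amalgam. -/
def toG (M : AmalgamModel p F) (j : Fin (M.n + 1)) : M.K j →* M.G :=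
  (QuotientGroup.mk' (Subgroup.normalClosure M.relators)).comp
    (Monoid.CoprodI.of (M := fun j => M.K j) (i := j))

/-- The embedding of `N_S(P_j)` in `K 0` through `S`. -/
def embN (M : AmalgamModel p F) (j : Fin (M.n + 1)) : M.N j →* M.K 0 :=
  M.embS.comp (M.N j).subtype

/-- `embS` is built from `emb 0`, so the relators with `j = 0` are trivial; this is `base`. -/
theorem isStarAmalgam (M : AmalgamModel p F) :
    IsStarAmalgam (ι := Fin (M.n + 1)) 0 (N := fun j => M.N j) (K := fun j => M.K j) M.emb M.embN
      M.toG where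
  base _ := rfl
  comm j x := by
    rw [← mul_inv_eq_one]
    have h : _ ∈ Subgroup.normalClosure M.relators := Subgroup.subset_normalClosure ⟨j, x, rfl⟩
    exact (QuotientGroup.eq_one_iff _).2 h
  closure_eq_top := CoprodI.iSup_range_mk'_eq_top _
  lift H _ h hh := by
    refine ⟨QuotientGroup.lift _ (Monoid.CoprodI.lift h) ?_, fun j x => ?_⟩
    · intro w hw
      have : Subgroup.normalClosure M.relators ≤ (Monoid.CoprodI.lift h).ker := by
        refine Subgroup.normalClosure_le_normal ?_
        rintro _ ⟨j, x, rfl⟩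
        have hx : h j (M.emb j x) = h 0 (M.embS x) := hh j x
        change Monoid.CoprodI.lift h _ = 1
        rw [map_mul, map_inv, Monoid.CoprodI.lift_of, Monoid.CoprodI.lift_of, hx, mul_inv_cancel]
      exact this hw
    · exact Monoid.CoprodI.lift_of h x

theorem embN_injective (M : AmalgamModel p F) (j : Fin (M.n + 1)) :
    Function.Injective (M.embN j) := by
  intro x y hxy
  have h := M.emb_injective 0 hxy
  have h' := congrArg Subtype.val h
  exact Subtype.ext h'

end AmalgamModel

/-- A sum `∑ 1 / (n j * i j) - ∑ 1 / n j` has a denominator dividing `s * lcm (i j)` if all the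
`n j` divide `s`. -/
theorem exists_int_eq_div_mul_lcm {ι : Type} [Fintype ι] [DecidableEq ι] (o : ι) {k n i : ι → ℕ}
    {s : ℕ} (hs : s ≠ 0) (hk : ∀ j, k j = n j * i j) (hk0 : ∀ j, k j ≠ 0) (hn : ∀ j, n j ∣ s) :
    ∃ d : ℤ, ∑ j, 1 / (k j : ℚ) - ∑ j ∈ Finset.univ.filter (fun j => j ≠ o), 1 / (n j : ℚ) =
      (d : ℚ) / ((s : ℚ) * ((Finset.univ.lcm i : ℕ) : ℚ)) := by
  choose c hc using hn
  choose e he using fun j => Finset.dvd_lcm (f := i) (Finset.mem_univ j)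
  have hi0 (j : ι) : i j ≠ 0 := fun h => hk0 j (by rw [hk, h, mul_zero])
  have hn0 (j : ι) : n j ≠ 0 := fun h => hk0 j (by rw [hk, h, zero_mul])
  have hl : Finset.univ.lcm i ≠ 0 := by
    rw [Ne, Finset.lcm_eq_zero_iff]
    simpa using hi0
  set l := Finset.univ.lcm i
  -- With `s = n j * c j` and `l = i j * e j`, one has `s * l / k j = c j * e j` and `s * l / n j =
  -- c j * l`.
  refine ⟨∑ j, (c j * e j : ℤ) - ∑ j ∈ Finset.univ.filter (fun j => j ≠ o), (c j * l : ℤ), ?_⟩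
  have hsq : (s : ℚ) ≠ 0 := Nat.cast_ne_zero.2 hs
  have hlq : (l : ℚ) ≠ 0 := Nat.cast_ne_zero.2 hl
  rw [eq_div_iff (mul_ne_zero hsq hlq), sub_mul, Finset.sum_mul, Finset.sum_mul]
  push_cast
  congr 1
  · refine Finset.sum_congr rfl fun j _ => ?_
    have h1 : (k j : ℚ) ≠ 0 := Nat.cast_ne_zero.2 (hk0 j)
    have h2 : (s * l : ℚ) = k j * (c j * e j) := by
      rw [hk]
      nth_rw 1 [hc j, he j]
      push_cast
      ring
    rw [h2]
    field_simp
  · refine Finset.sum_congr rfl fun j _ => ?_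
    have h1 : (n j : ℚ) ≠ 0 := Nat.cast_ne_zero.2 (hn0 j)
    have h2 : (s : ℚ) = n j * c j := by exact_mod_cast hc j
    rw [h2]
    field_simp

theorem mainTheorem11 {p : ℕ} [Fact p.Prime] {S : Type} [Group S] [Finite S]
    (hS : IsPGroup p S) (F : FusionSystem S) (hF : F.IsSaturated p) (M : AmalgamModel p F) :
    ∃ χ : ℚ, HasRationalEulerChar M.G χ ∧
      χ = (∑ j, 1 / (Nat.card (M.K j) : ℚ)) -
        ∑ j ∈ Finset.univ.filter (fun j => j ≠ 0), 1 / (Nat.card (M.N j) : ℚ) ∧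
      ∃ d : ℤ, χ = (d : ℚ) / ((Nat.card S : ℚ) * ((Finset.univ.lcm M.relIndex : ℕ) : ℚ)) ∧
        (¬ IsVirtuallyCyclic M.G → d < 0) := by
  refine ⟨_, M.isStarAmalgam.hasRationalEulerChar M.emb_injective M.embN_injective, rfl, ?_⟩
  obtain ⟨d, hd⟩ := exists_int_eq_div_mul_lcm (0 : Fin (M.n + 1)) (k := fun j => Nat.card (M.K j))
    (n := fun j => Nat.card (M.N j)) (i := M.relIndex) (s := Nat.card S) Nat.card_pos.ne'
    (fun j => by
      rw [AmalgamModel.relIndex, ← (M.emb j).range.card_mul_index,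
        ← Nat.card_congr (MonoidHom.ofInjective (M.emb_injective j)).toEquiv]
      rfl)
    (fun j => Nat.card_pos.ne') (fun j => Subgroup.card_subgroup_dvd_card _)
  refine ⟨d, hd, fun hG => ?_⟩
  by_contra! hd0
  refine hG (M.isStarAmalgam.isVirtuallyCyclic_of_nonneg M.emb_injective M.embN_injective ?_)
  refine le_of_le_of_eq ?_ hd.symm
  have : (0 : ℚ) ≤ d := by exact_mod_cast hd0
  positivity
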